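/- Let $\Bbbk$ be an algebraically closed field and let $A$ be a finite-dimensional associative unital $\Bbbk$-algebra. Let $A\text{-mod}$ be the category of finite-dimensional left $A$-modules. Let the isomorphism classes of simple $A$-modules be labelled by $\Lambda=\{1<2<\dots<n\}$, with representatives $L(\lambda)$, projective covers $P(\lambda)$ and injective envelopes $I(\lambda)$. The trace of a module $X$ in a module $M$ is the sum of the images of all homomorphisms $X\to M$; the reject of $X$ in $M$ is the intersection of the kernels of all homomorphisms $M\to X$. Let - $\Delta(\lambda)$ (the standard module) be the quotient of $P(\lambda)$ by the trace of $\bigoplus_{\mu>\lambda}P(\mu)$ in $P(\lambda)$; - $\nabla(\lambda)$ (the costandard module) be the reject of $\bigoplus_{\mu>\lambda}I(\mu)$ in $I(\lambda)$; - $\overline{\nabla}(\lambda)$ (the proper costandard module) be the submodule of $\nabla(\lambda)$ containing $\operatorname{soc}\nabla(\lambda)$ for which $\overline{\nabla}(\lambda)/\operatorname{soc}\nabla(\lambda)$ is the reject of $I(\lambda)$ in $\nabla(\lambda)/\operatorname{soc}\nabla(\lambda)$. Let $\mathcal F(\Delta)$ and $\mathcal F(\overline{\nabla})$ be the full subcategories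 of $A\text{-mod}$ consisting of the modules that have a finite filtration whose subquotients are isomorphic to modules $\Delta(\lambda)$, respectively $\overline{\nabla}(\lambda)$, with $\lambda\in\Lambda$. Assume that $A$ is an SSS-algebra (strongly standardly stratified), that is, ${}_AA\in\mathcal F(\Delta)$. Let $T$ be a characteristic tilting module, that is, a finite-dimensional $A$-module such that the direct summands of finite direct sums of copies of $T$ are, up to isomorphism, exactly the modules in $\mathcal F(\Delta)\cap\mathcal F(\overline{\nabla})$. For $M\in A\text{-mod}$ let $\operatorname{pd}(M)$ be its projective dimension, and let $\dim_\Delta(M)\in\{0,1,\dots,\infty\}$ be the length of a shortest finite resolution of $M$ by modules in $\mathcal F(\Delta)$ ($\infty$ if there is none). Let $\operatorname{fdim}(A)$ be the supremum of $\operatorname{pd}(M)$ over all $M\in A\text{-mod}$ with $\operatorname{pd}(M)<\infty$, and let $\operatorname{fdim}_\Delta(A)$ be the supremum of $\dim_\Delta(M)$ over all $M\in A\text{-mod}$ with $\dim_\Delta(M)<\infty$. Then $$\operatorname{fdim}(A)\le\operatorname{fdim}_\Delta(A)+\operatorname{pd}(T).$$ -/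

import Mathlib

open CategoryTheory

universe u v

namespace Strat

section General

variable {A : Type u} [Ring A]

/-- `p : P → L` exhibits `P` as a projective cover of `L`: `P` is projective and `p` is surjective
with superfluous kernel. -/
def IsProjectiveCoverMap {P L : ModuleCat.{u} A} (p : P →ₗ[A] L) : Prop :=
  Module.Projective A P ∧ Function.Surjective p ∧
    ∀ N : Submodule A P, N ⊔ LinearMap.ker p = ⊤ → N = ⊤

/-- `j : L → I` exhibits `I` as an injective envelope of `L`: `I` is injective and `j` is injective
with essential image. -/
def IsInjectiveEnvelopeMap {L I : ModuleCat.{u} A} (j : L →ₗ[A] I) : Prop :=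
  Module.Injective A I ∧ Function.Injective j ∧
    ∀ N : Submodule A I, N ⊓ LinearMap.range j = ⊥ → N = ⊥

/-- The trace of `X` in `M`: the sum of the images of all homomorphisms `X → M`. -/
def traceOf (X M : Type u) [AddCommGroup X] [Module A X] [AddCommGroup M] [Module A M] :
    Submodule A M :=
  ⨆ f : X →ₗ[A] M, LinearMap.range f

/-- The reject of `X` in `M` (the notion dual to the trace): the intersection of the kernels of
all homomorphisms `M → X`. -/
def rejectOf (M X : Type u) [AddCommGroup M] [Module A M] [AddCommGroup X] [Module A X] :
    Submodule A M :=
  ⨅ f : M →ₗ[A] X, LinearMap.ker f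

variable (A) in
/-- The socle of `M`: the sum of all simple submodules. -/
def socle (M : Type u) [AddCommGroup M] [Module A M] : Submodule A M :=
  sSup {N : Submodule A M | IsSimpleModule A N}

/-- `M` belongs to `𝓕(X)`: there is a finite filtration `0 = F₀ ⊆ F₁ ⊆ ⋯ ⊆ F_l = M` each of whose
subquotients `F_{i+1} / F_i` is isomorphic to some `X j`. -/
def Filtered {ι : Type} (X : ι → ModuleCat.{u} A) (M : ModuleCat.{u} A) : Prop :=
  ∃ (l : ℕ) (F : ℕ → Submodule A M), Monotone F ∧ F 0 = ⊥ ∧ F l = ⊤ ∧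
    ∀ i < l, ∃ j, Nonempty ((F (i + 1) ⧸ (F i).submoduleOf (F (i + 1))) ≃ₗ[A] X j)

/-- `N` has a resolution `0 → R_l → ⋯ → R_1 → R_0 → N → 0` (an exact sequence) of length at most
`l` with all `R_i` in `𝓕(X)`; the terms `R_i` with `i > l` are zero. -/
def HasFilteredResolution {ι : Type} (X : ι → ModuleCat.{u} A) (N : ModuleCat.{u} A) (l : ℕ) :
    Prop :=
  ∃ (R : ℕ → ModuleCat.{u} A) (d : ∀ i, R (i + 1) →ₗ[A] R i) (ε : R 0 →ₗ[A] N),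
    (∀ i, Filtered X (R i)) ∧ (∀ i, l < i → Subsingleton (R i)) ∧
    Function.Surjective ε ∧ Function.Exact (d 0) ε ∧
    ∀ i, Function.Exact (d (i + 1)) (d i)

/-- The filtration dimension of `N` with respect to `X`: the length of a shortest resolution of `N`
by modules from `𝓕(X)`, and `⊤` if there is no finite one. -/
noncomputable def filtrationDim {ι : Type} (X : ι → ModuleCat.{u} A) (N : ModuleCat.{u} A) : ℕ∞ :=
  ⨅ (l : ℕ) (_ : HasFilteredResolution X N l), (l : ℕ∞)

variable (A) in
/-- The (projectively defined) finitistic dimension: the supremum of the projective dimensions of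
the finitely generated (over a finite-dimensional algebra: finite-dimensional) left modules of
finite projective dimension. -/
noncomputable def fdim : WithBot ℕ∞ :=
  ⨆ (M : ModuleCat.{u} A) (_ : Module.Finite A M) (_ : projectiveDimension M ≠ ⊤),
    projectiveDimension M

/-- `M` belongs to the additive closure of `T`: it is isomorphic to a direct summand of a finite
direct sum of copies of `T`. -/
def InAdd (T M : ModuleCat.{u} A) : Prop :=
  ∃ (m : ℕ) (i : M →ₗ[A] (Fin m → T)) (r : (Fin m → T) →ₗ[A] M), r ∘ₗ i = LinearMap.id

end General

variable (A : Type u) [Ring A]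

/-- A labelling by `{1 < ⋯ < n}` of the isomorphism classes of simple left `A`-modules, with a
choice of representatives `L i`, of projective covers `P i → L i` and of injective envelopes
`L i → I i`. -/
structure SimpleData (n : ℕ) where
  L : Fin n → ModuleCat.{u} A
  P : Fin n → ModuleCat.{u} A
  I : Fin n → ModuleCat.{u} A
  p : ∀ i, P i →ₗ[A] L i
  j : ∀ i, L i →ₗ[A] I i
  simple : ∀ i, IsSimpleModule A (L i)
  eq_of_equiv : ∀ i i', Nonempty (L i ≃ₗ[A] L i') → i = i'
  exists_equiv : ∀ S : ModuleCat.{u} A, IsSimpleModule A S → ∃ i, Nonempty (S ≃ₗ[A] L i)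
  cover : ∀ i, IsProjectiveCoverMap (p i)
  envelope : ∀ i, IsInjectiveEnvelopeMap (j i)

namespace SimpleData

variable {A} {n : ℕ} (S : SimpleData A n)

/-- The standard module `Δ(i)`: the quotient of `P(i)` by the trace of `⨁_{m > i} P(m)`, which is
the sum of the traces of the `P(m)` with `m > i`. -/
noncomputable def Δ (i : Fin n) : ModuleCat.{u} A :=
  ModuleCat.of A (S.P i ⧸ (⨆ (m : Fin n) (_ : i < m), traceOf (S.P m) (S.P i) :
    Submodule A (S.P i)))

/-- The costandard module `∇(i)`: the reject of `⨁_{m > i} I(m)` in `I(i)`. -/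
def costd (i : Fin n) : Submodule A (S.I i) :=
  ⨅ (m : Fin n) (_ : i < m), rejectOf (S.I i) (S.I m)

/-- The proper costandard module `∇̄(i)`: the submodule of `∇(i)` containing the socle of `∇(i)`
such that `∇̄(i) / soc ∇(i)` is the reject of `I(i)` in `∇(i) / soc ∇(i)`. -/
noncomputable def properCostd (i : Fin n) : ModuleCat.{u} A :=
  ModuleCat.of A ((rejectOf (S.costd i ⧸ socle A (S.costd i)) (S.I i)).comap
    (socle A (S.costd i)).mkQ)

/-- `A` is an SSS-algebra for the given labelling: the left regular module has a filtration with
standard subquotients. -/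
def IsSSS : Prop := Filtered S.Δ (ModuleCat.of A A)

/-- `T` is a characteristic tilting module: `T` is finite-dimensional and its additive closure is
`𝓕(Δ) ∩ 𝓕(∇̄)`. -/
def IsCharacteristicTilting (T : ModuleCat.{u} A) : Prop :=
  Module.Finite A T ∧ ∀ M : ModuleCat.{u} A, Module.Finite A M →
    (InAdd T M ↔ Filtered S.Δ M ∧ Filtered S.properCostd M)

/-- The finitistic standard filtration dimension: the supremum of the standard filtration
dimensions `dim_Δ(M)` over all finite-dimensional `M` for which this dimension is finite. -/
noncomputable def fdimΔ : ℕ∞ :=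
  ⨆ (M : ModuleCat.{u} A) (_ : Module.Finite A M) (_ : filtrationDim S.Δ M ≠ ⊤),
    filtrationDim S.Δ M

end SimpleData

end Strat

/-!
A module `M` of finite projective dimension has a finite resolution by finite projective modules.
These lie in `𝓕(Δ)`, so `l = dim_Δ(M)` is finite, and a resolution of length `l` by modules in
`𝓕(Δ)` gives `pd M ≤ l + pd T` as soon as `pd X ≤ pd T` for all `X ∈ 𝓕(Δ)`. The latter holds because every
such `X` has a finite coresolution in `add T`: there is an exact sequence `0 → X → T₀ → Y → 0` with
`T₀ ∈ add T`, in which `Y ∈ 𝓕(Δ)` has only factors `Δ(i)` of index smaller than the largest one that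
occurs in `X` (`IsSSS.hasProjectiveDimensionLT_of_ΔLT`).

The sequence is an iterated universal extension. As `Ext¹(Δ(i), Δ(j)) = 0` for `i ≥ j`, extending
`X` by copies of `Δ(c - 1), …, Δ(0)` in turn produces `T₀ ∈ 𝓕(Δ)` with `Ext¹(Δ(i), T₀) = 0` for all
`i` (`exists_embedding_extVanishes`), and for an SSS-algebra such a module is in `𝓕(∇̄)`
(`IsSSS.filtered_properCostd`). Dually, `Ext¹(M, ∇̄(i)) = 0` for all `i` implies `M ∈ 𝓕(Δ)`
(`IsSSS.filtered_Δ`), which applies to projective modules.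

Both criteria rest on `Ext¹(Δ(j), ∇̄(i)) = 0`, which holds for any algebra
(`extVanishes_Δ_properCostd`), and on `Ext²(Δ(j), ∇̄(i)) = 0`, which is where `A ∈ 𝓕(Δ)` enters: the
syzygy of `Δ(j)` is the trace of the `P(m)`, `m > j`, in `P(j)`, a direct summand of the
corresponding trace in `A`, and such traces in modules of `𝓕(Δ)` again have the vanishing property
(`extVanishes_traceGT`).

Only the vanishing of `Ext¹` and `Ext²` matters here, so `Ext¹(X, Y) = 0` is expressed as an
extension property of homomorphisms (`ExtVanishes`), and `Ext²` is `Ext¹` of a syzygy. That `L(m)`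
is not a composition factor of `M` is expressed as `Hom(P(m), M) = 0` (`Omits`).
-/

namespace Strat

/-! ### Vanishing of first extension groups -/

section Extensions

variable {A : Type u} [Ring A]
variable {X X' Y Z M N P : Type u} [AddCommGroup X] [Module A X] [AddCommGroup X'] [Module A X']
  [AddCommGroup Y] [Module A Y] [AddCommGroup Z] [Module A Z] [AddCommGroup M] [Module A M]
  [AddCommGroup N] [Module A N] [AddCommGroup P] [Module A P]

variable (A X Y) in
/-- The vanishing of `Ext¹(X, Y)`, in the form: whenever `N` is an extension of `X`, every
homomorphism to `Y` from the kernel of `N → X` extends to `N`. -/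
def ExtVanishes : Prop :=
  ∀ (N : Type u) [AddCommGroup N] [Module A N] (g : N →ₗ[A] X), Function.Surjective g →
    ∀ h : LinearMap.ker g →ₗ[A] Y, ∃ h' : N →ₗ[A] Y, ∀ x : LinearMap.ker g, h' x = h x

theorem exists_factor_of_ker_le {φ : M →ₗ[A] N} (hφ : Function.Surjective φ) (ψ : M →ₗ[A] Y)
    (hle : ∀ x, φ x = 0 → ψ x = 0) : ∃ h : N →ₗ[A] Y, ∀ x, h (φ x) = ψ x := by
  refine ⟨(LinearMap.ker φ).liftQ ψ (fun x hx => hle x hx) ∘ₗ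
    (φ.quotKerEquivOfSurjective hφ).symm.toLinearMap, fun x => ?_⟩
  have : (φ.quotKerEquivOfSurjective hφ).symm (φ x) = (LinearMap.ker φ).mkQ x := by
    rw [LinearEquiv.symm_apply_eq]; rfl
  simpa [this] using Submodule.liftQ_apply _ _ x

theorem exists_lift_of_injective {f : M →ₗ[A] N} (hf : Function.Injective f) (h : X →ₗ[A] N)
    (hr : ∀ x, ∃ y, f y = h x) : ∃ h' : X →ₗ[A] M, ∀ x, f (h' x) = h x := by
  refine ⟨(LinearEquiv.ofInjective f hf).symm.toLinearMap ∘ₗ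
    h.codRestrict (LinearMap.range f) (fun x => hr x), fun x => ?_⟩
  have := LinearEquiv.apply_symm_apply (LinearEquiv.ofInjective f hf)
    (h.codRestrict (LinearMap.range f) (fun x => hr x) x)
  exact congrArg Subtype.val this

theorem ExtVanishes.exists_extension (hXY : ExtVanishes A X Y) {f : M →ₗ[A] N} {g : N →ₗ[A] X}
    (hf : Function.Injective f) (hg : Function.Surjective g) (hfg : Function.Exact f g)
    (h : M →ₗ[A] Y) : ∃ h' : N →ₗ[A] Y, ∀ x, h' (f x) = h x := by
  obtain ⟨t, ht⟩ := exists_lift_of_injective hf (LinearMap.ker g).subtype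
    (fun x => (hfg x).1 x.2)
  obtain ⟨h', hh'⟩ := hXY N g hg (h ∘ₗ t)
  refine ⟨h', fun x => ?_⟩
  have hx : g (f x) = 0 := (hfg _).2 ⟨x, rfl⟩
  have := hh' ⟨f x, hx⟩
  simp only [LinearMap.comp_apply] at this
  rw [this]
  congr 1
  exact hf (ht ⟨f x, hx⟩)

/-- It suffices to test the vanishing of `Ext¹(X, Y)` on one projective presentation of `X`. -/
theorem ExtVanishes.of_presentation [Module.Projective A P] {π : P →ₗ[A] X}
    (hπ : Function.Surjective π)
    (H : ∀ h : LinearMap.ker π →ₗ[A] Y, ∃ h' : P →ₗ[A] Y, ∀ x : LinearMap.ker π, h' x = h x) :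
    ExtVanishes A X Y := by
  intro N _ _ g hg h
  obtain ⟨t, ht⟩ := Module.projective_lifting_property g π hg
  have ht' : ∀ x, g (t x) = π x := fun x => LinearMap.congr_fun ht x
  obtain ⟨e, he⟩ := H (h ∘ₗ t.restrict (p := LinearMap.ker π) (q := LinearMap.ker g)
    (fun x hx => by simpa [ht'] using hx))
  -- `N` is the pushout of `ker g` and `P` along `ker π`.
  obtain ⟨h', hh'⟩ := exists_factor_of_ker_le (A := A)
    (φ := (LinearMap.ker g).subtype.coprod t) (fun n => by
      obtain ⟨p, hp⟩ := hπ (g n)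
      exact ⟨(⟨n - t p, by simp [ht', hp]⟩, p), by simp⟩)
    (h.coprod e) (by
      rintro ⟨a, p⟩ hap
      have hap : (a : N) + t p = 0 := by simpa using hap
      have hp : π p = 0 := by
        have := congrArg g hap
        simpa [ht'] using this
      have := he ⟨p, hp⟩
      simp only [LinearMap.coprod_apply]
      rw [this, LinearMap.comp_apply, ← map_add]
      convert map_zero h
      exact Subtype.ext hap)
  exact ⟨h', fun x => by simpa using hh' (x, 0)⟩

theorem ExtVanishes.of_projective [Module.Projective A X] : ExtVanishes A X Y := by
  refine .of_presentation (π := LinearMap.id (R := A) (M := X)) Function.surjective_id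
    fun h => ⟨0, fun x => ?_⟩
  rw [show x = 0 from Subtype.ext x.2, map_zero h]
  rfl

/-- If `Ext¹(X, Y) = 0`, then homomorphisms `ker g → Y` extend to the pullback of `g : N → X'` along
any `r : X → X'`. -/
theorem ExtVanishes.exists_extension_pullback (hXY : ExtVanishes A X Y) {g : N →ₗ[A] X'}
    (hg : Function.Surjective g) (r : X →ₗ[A] X') (h : LinearMap.ker g →ₗ[A] Y) :
    ∃ e : LinearMap.eqLocus (g ∘ₗ LinearMap.fst A N X) (r ∘ₗ LinearMap.snd A N X) →ₗ[A] Y,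
      ∀ n (hn : g n = 0), e ⟨(n, 0), by simp [hn]⟩ = h ⟨n, hn⟩ := by
  let W := LinearMap.eqLocus (g ∘ₗ LinearMap.fst A N X) (r ∘ₗ LinearMap.snd A N X)
  obtain ⟨e, he⟩ := hXY.exists_extension (N := W)
    (f := ((LinearMap.inl A N X) ∘ₗ (LinearMap.ker g).subtype).codRestrict W
      (fun x => by
        have : g x = 0 := x.2
        simp [W, this])) (g := LinearMap.snd A N X ∘ₗ W.subtype)
    (fun x y hxy => Subtype.ext (congrArg (fun z : W => z.1.1) hxy))
    (fun x => by
      obtain ⟨n, hn⟩ := hg (r x)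
      exact ⟨⟨(n, x), by simp [W, hn]⟩, rfl⟩)
    (by
      rintro ⟨⟨n, x⟩, hw⟩
      have hw : g n = r x := by simpa [W] using hw
      constructor
      · intro hx
        have hx : x = 0 := hx
        subst hx
        exact ⟨⟨n, by simpa using hw⟩, rfl⟩
      · rintro ⟨y, hy⟩
        exact (congrArg (fun z => z.1.2) hy).symm) h
  exact ⟨e, fun n hn => he ⟨n, hn⟩⟩

/-- `Ext¹(-, Y) = 0` is inherited by direct summands. -/
theorem ExtVanishes.of_retract (hXY : ExtVanishes A X Y) (i : X' →ₗ[A] X) (r : X →ₗ[A] X')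
    (hri : ∀ x, r (i x) = x) : ExtVanishes A X' Y := by
  intro N _ _ g hg h
  obtain ⟨e, he⟩ := hXY.exists_extension_pullback hg r h
  refine ⟨e ∘ₗ (LinearMap.id.prod (i ∘ₗ g)).codRestrict _ (fun n => by simp [hri]),
    fun x => ?_⟩
  rw [← he x x.2, LinearMap.comp_apply]
  congr 1
  refine Subtype.ext (Prod.ext rfl ?_)
  change i (g x) = 0
  rw [show g x = 0 from x.2, map_zero]

theorem ExtVanishes.congr_left (hXY : ExtVanishes A X Y) (e : X ≃ₗ[A] X') :
    ExtVanishes A X' Y :=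
  hXY.of_retract e.symm.toLinearMap e.toLinearMap (by simp)

theorem ExtVanishes.congr_right (hXY : ExtVanishes A X Y) (e : Y ≃ₗ[A] Z) :
    ExtVanishes A X Z := by
  intro N _ _ g hg h
  obtain ⟨h', hh'⟩ := hXY N g hg (e.symm.toLinearMap ∘ₗ h)
  exact ⟨e.toLinearMap ∘ₗ h', fun x => by simp [hh']⟩

/-- `Ext¹(-, Y) = 0` is closed under extensions. -/
theorem ExtVanishes.of_extension {π : X →ₗ[A] X'} (hπ : Function.Surjective π)
    (h₁ : ExtVanishes A (LinearMap.ker π) Y) (h₂ : ExtVanishes A X' Y) :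
    ExtVanishes A X Y := by
  intro N _ _ g hg h
  let W := LinearMap.ker (π ∘ₗ g)
  obtain ⟨e, he⟩ := h₁.exists_extension (N := W)
    (f := (LinearMap.ker g).subtype.codRestrict W (fun x => by
      have : g x = 0 := x.2
      simp [W, this]))
    (g := g.restrict (p := W) (q := LinearMap.ker π) (fun x hx => hx))
    (fun x y hxy => Subtype.ext (congrArg (fun z : W => z.1) hxy))
    (fun x => by
      obtain ⟨n, hn⟩ := hg x
      exact ⟨⟨n, by simp [W, hn]⟩, Subtype.ext hn⟩)
    (fun w => ⟨fun hw => ⟨⟨w, congrArg Subtype.val hw⟩, rfl⟩, by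
      rintro ⟨y, rfl⟩; exact Subtype.ext y.2⟩) h
  obtain ⟨e', he'⟩ := h₂ N (π ∘ₗ g) (hπ.comp hg) e
  refine ⟨e', fun x => ?_⟩
  rw [← he x, ← he']
  rfl

/-- The exact sequence `Hom(X₀, Y) → Ext¹(X', Y) → Ext¹(X, Y)` of `0 → X₀ → X → X' → 0`. -/
theorem ExtVanishes.of_quotient {π : X →ₗ[A] X'} (hπ : Function.Surjective π)
    (h₁ : ∀ f : LinearMap.ker π →ₗ[A] Y, f = 0) (h₂ : ExtVanishes A X Y) :
    ExtVanishes A X' Y := by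
  intro N _ _ g hg h
  obtain ⟨e, he⟩ := h₂.exists_extension_pullback hg π h
  let W := LinearMap.eqLocus (g ∘ₗ LinearMap.fst A N X) (π ∘ₗ LinearMap.snd A N X)
  obtain ⟨h', hh'⟩ := exists_factor_of_ker_le (A := A) (φ := LinearMap.fst A N X ∘ₗ W.subtype)
    (fun n => by
      obtain ⟨x, hx⟩ := hπ (g n)
      exact ⟨⟨(n, x), by simp [W, hx]⟩, rfl⟩) e (by
      rintro ⟨⟨n, x⟩, hw⟩ hn
      have hn : n = 0 := hn
      subst hn
      have hx : π x = 0 := by simpa [W, eq_comm] using hw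
      exact LinearMap.congr_fun (h₁ (e ∘ₗ ((LinearMap.inr A N X) ∘ₗ
        (LinearMap.ker π).subtype).codRestrict W
          (fun x => by
            have : π x = 0 := x.2
            simp [W, this]))) ⟨x, hx⟩)
  exact ⟨h', fun x => (hh' ⟨(x, 0), _⟩).trans (he x x.2)⟩

/-- The exact sequence `Hom(X, Z / Y) → Ext¹(X, Y) → Ext¹(X, Z)` of a submodule `Y` of `Z`. -/
theorem ExtVanishes.of_injective {β : Y →ₗ[A] Z} (hβ : Function.Injective β)
    (h₁ : ∀ f : X →ₗ[A] Z ⧸ LinearMap.range β, f = 0) (h₂ : ExtVanishes A X Z) :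
    ExtVanishes A X Y := by
  intro N _ _ g hg f
  obtain ⟨e, he⟩ := h₂ N g hg (β ∘ₗ f)
  obtain ⟨d, hd⟩ := exists_factor_of_ker_le hg ((LinearMap.range β).mkQ ∘ₗ e) fun x hx =>
    (Submodule.Quotient.mk_eq_zero _).2 ⟨f ⟨x, hx⟩, (he ⟨x, hx⟩).symm⟩
  obtain ⟨e', he'⟩ := exists_lift_of_injective hβ e fun x => by
    refine (Submodule.Quotient.mk_eq_zero (LinearMap.range β)).1 ?_
    rw [← Submodule.mkQ_apply, ← LinearMap.comp_apply, ← hd, h₁ d, LinearMap.zero_apply]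
  exact ⟨e', fun x => hβ ((he' x).trans (he x))⟩

/-- If `Ext¹(X, ker φ) = 0`, then homomorphisms from `X` lift along the surjection `φ`. -/
theorem ExtVanishes.exists_lift {φ : Y →ₗ[A] Z} (hφ : Function.Surjective φ)
    (hX : ExtVanishes A X (LinearMap.ker φ)) (t : X →ₗ[A] Z) :
    ∃ s : X →ₗ[A] Y, ∀ x, φ (s x) = t x := by
  obtain ⟨e, he⟩ := hX.exists_extension_pullback hφ t LinearMap.id
  let W := LinearMap.eqLocus (φ ∘ₗ LinearMap.fst A Y X) (t ∘ₗ LinearMap.snd A Y X)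
  obtain ⟨s, hs⟩ := exists_factor_of_ker_le (A := A) (φ := LinearMap.snd A Y X ∘ₗ W.subtype)
    (fun x => by
      obtain ⟨n, hn⟩ := hφ (t x)
      exact ⟨⟨(n, x), by simp [W, hn]⟩, rfl⟩)
    (LinearMap.fst A Y X ∘ₗ W.subtype - (LinearMap.ker φ).subtype ∘ₗ e) (by
      rintro ⟨⟨n, x⟩, hw⟩ hx
      have hx : x = 0 := hx
      subst hx
      have hn : φ n = 0 := by simpa [W] using hw
      have := congrArg Subtype.val (he n hn)
      exact sub_eq_zero.2 this.symm)
  refine ⟨s, fun x => ?_⟩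
  obtain ⟨n, hn⟩ := hφ (t x)
  have := hs ⟨(n, x), by simp [W, hn]⟩
  have h2 : s x = n - (e ⟨(n, x), by simp [hn]⟩ : LinearMap.ker φ) := this
  rw [h2, map_sub, hn, LinearMap.mem_ker.1 (Subtype.prop _), sub_zero]

/-- `Ext¹(X, -) = 0` is closed under extensions. -/
theorem ExtVanishes.of_extension_right {φ : Y →ₗ[A] Z} (hφ : Function.Surjective φ)
    (h₁ : ExtVanishes A X (LinearMap.ker φ)) (h₂ : ExtVanishes A X Z) :
    ExtVanishes A X Y := by
  have hπ : Function.Surjective (Finsupp.linearCombination A (id : X → X)) :=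
    Finsupp.linearCombination_id_surjective A X
  refine .of_presentation hπ fun h => ?_
  obtain ⟨a, ha⟩ := h₂ _ _ hπ (φ ∘ₗ h)
  obtain ⟨b, hb⟩ := Module.projective_lifting_property φ a hφ
  have hb' : ∀ x, φ (b x) = a x := fun x => LinearMap.congr_fun hb x
  obtain ⟨c, hc⟩ := h₁ _ _ hπ ((h - b ∘ₗ (LinearMap.ker _).subtype).codRestrict
    (LinearMap.ker φ) (fun x => by simp [hb', ha]))
  exact ⟨b + (LinearMap.ker φ).subtype ∘ₗ c, fun x => by
    simp only [LinearMap.add_apply, LinearMap.comp_apply, hc]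
    exact add_sub_cancel _ _⟩

/-- The exact sequence `Ext¹(X, Y) → Ext¹(X, Z) → Ext²(X, Y₀)` of `0 → Y₀ → Y → Z → 0`; here
`Ext²(X, Y₀)` is expressed as `Ext¹` of a syzygy of `X`. -/
theorem ExtVanishes.of_quotient_right [Module.Projective A P] {π : P →ₗ[A] X}
    (hπ : Function.Surjective π) {φ : Y →ₗ[A] Z} (hφ : Function.Surjective φ)
    (h₁ : ExtVanishes A (LinearMap.ker π) (LinearMap.ker φ)) (h₂ : ExtVanishes A X Y) :
    ExtVanishes A X Z := by
  refine .of_presentation hπ fun h => ?_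
  obtain ⟨s, hs⟩ := h₁.exists_lift hφ h
  obtain ⟨e, he⟩ := h₂ _ _ hπ s
  exact ⟨φ ∘ₗ e, fun x => by simp [he, hs]⟩

/-- The exact sequence `Ext¹(X, Y) → Ext¹(X₀, Y) → Ext²(X', Y)` of `0 → X₀ → X → X' → 0`; here
`Ext²(X', Y)` is expressed as `Ext¹` of a syzygy of `X'`. -/
theorem ExtVanishes.ker_of_syzygy [Module.Projective A P] {π : P →ₗ[A] X'}
    (hπ : Function.Surjective π) {ρ : X →ₗ[A] X'} (hρ : Function.Surjective ρ)
    (h₁ : ExtVanishes A (LinearMap.ker π) Y) (h₂ : ExtVanishes A X Y) :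
    ExtVanishes A (LinearMap.ker ρ) Y := by
  obtain ⟨t, ht⟩ := Module.projective_lifting_property ρ π hρ
  have ht' : ∀ x, ρ (t x) = π x := fun x => LinearMap.congr_fun ht x
  -- There is an exact sequence `0 → ker π → ker ρ × P → X → 0`.
  let q : (LinearMap.ker ρ × P) →ₗ[A] X := (LinearMap.ker ρ).subtype.coprod t
  have hq : Function.Surjective q := fun x => by
    obtain ⟨p, hp⟩ := hπ (ρ x)
    exact ⟨(⟨x - t p, by simp [ht', hp]⟩, p), by simp [q]⟩
  have hker : ExtVanishes A (LinearMap.ker q) Y := by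
    refine h₁.of_retract
      ((LinearMap.snd A _ P ∘ₗ (LinearMap.ker q).subtype).codRestrict _ ?_)
      (((-(t.restrict (p := LinearMap.ker π) (q := LinearMap.ker ρ) fun x hx => by
        simpa [ht'] using hx)).prod (LinearMap.ker π).subtype).codRestrict _ ?_) ?_
    · rintro ⟨⟨a, p⟩, h⟩
      have := congrArg ρ (show (a : X) + t p = 0 by simpa [q] using h)
      simpa [ht'] using this
    · intro x
      simp [q]
    · rintro ⟨⟨a, p⟩, h⟩
      have h : (a : X) + t p = 0 := by simpa [q] using h
      refine Subtype.ext (Prod.ext (Subtype.ext ?_) rfl)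
      simpa using (eq_neg_of_add_eq_zero_left h).symm
  exact (ExtVanishes.of_extension hq hker h₂).of_retract (LinearMap.inl A _ P)
    (LinearMap.fst A _ P) (by simp)

end Extensions

/-! ### Modules with a filtration -/

section Filtrations

variable {A : Type u} [Ring A] {ι : Type} {X : ι → ModuleCat.{u} A}

theorem nonempty_subquotient_equiv_iff {M D : Type u} [AddCommGroup M] [Module A M]
    [AddCommGroup D] [Module A D] (U V : Submodule A M) :
    Nonempty ((V ⧸ U.submoduleOf V) ≃ₗ[A] D) ↔
      ∃ g : V →ₗ[A] D, Function.Surjective g ∧ ∀ x : V, g x = 0 ↔ (x : M) ∈ U := by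
  constructor
  · rintro ⟨e⟩
    refine ⟨e.toLinearMap ∘ₗ (U.submoduleOf V).mkQ,
      e.surjective.comp (Submodule.mkQ_surjective _), fun x => ?_⟩
    rw [LinearMap.comp_apply, LinearEquiv.coe_coe, e.map_eq_zero_iff, Submodule.mkQ_apply,
      Submodule.Quotient.mk_eq_zero]
    rfl
  · rintro ⟨g, hg, hgU⟩
    have : U.submoduleOf V = LinearMap.ker g := by
      ext x
      simp [Submodule.submoduleOf, hgU]
    exact ⟨(Submodule.quotEquivOfEq _ _ this).trans (g.quotKerEquivOfSurjective hg)⟩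

theorem Filtered.of_subsingleton (M : Type u) [AddCommGroup M] [Module A M] [Subsingleton M] :
    Filtered X (ModuleCat.of A M) :=
  ⟨0, fun _ => ⊥, fun _ _ _ => le_rfl, rfl, Subsingleton.elim (α := Submodule A M) _ _,
    fun i hi => absurd hi (Nat.not_lt_zero i)⟩

theorem Filtered.of_equiv {M N : Type u} [AddCommGroup M] [Module A M] [AddCommGroup N]
    [Module A N] (h : Filtered X (ModuleCat.of A M)) (e : M ≃ₗ[A] N) :
    Filtered X (ModuleCat.of A N) := by
  obtain ⟨l, F, hF, h0, hl, hs⟩ := h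
  refine ⟨l, fun i => (F i).comap e.symm.toLinearMap,
    fun i j hij => Submodule.comap_mono (hF hij), ?_, ?_, fun i hi => ?_⟩
  · simp only [h0]
    exact LinearMap.ker_eq_bot.2 e.symm.injective
  · simp only [hl]
    rfl
  · obtain ⟨j, hj⟩ := hs i hi
    obtain ⟨g, hg, hgU⟩ := (nonempty_subquotient_equiv_iff _ _).1 hj
    refine ⟨j, (nonempty_subquotient_equiv_iff _ _).2
      ⟨g ∘ₗ e.symm.toLinearMap.restrict fun x hx => hx, fun d => ?_, fun x => hgU _⟩⟩
    obtain ⟨⟨y, hy⟩, rfl⟩ := hg d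
    exact ⟨⟨e y, by simpa using hy⟩, congrArg g (Subtype.ext (e.symm_apply_apply y))⟩

/-- A filtration of the kernel of a surjection `M → X j` extends to one of `M`. -/
theorem Filtered.of_ker {M : Type u} [AddCommGroup M] [Module A M] {j : ι} {g : M →ₗ[A] X j}
    (hg : Function.Surjective g) (h : Filtered X (ModuleCat.of A (LinearMap.ker g))) :
    Filtered X (ModuleCat.of A M) := by
  obtain ⟨l, F, hF, h0, hl, hs⟩ := h
  have hmap : ∀ (U : Submodule A (LinearMap.ker g)) (x : LinearMap.ker g),
      (x : M) ∈ U.map (LinearMap.ker g).subtype ↔ x ∈ U := fun U x => by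
    simp
  refine ⟨l + 1, fun i => if i ≤ l then (F i).map (LinearMap.ker g).subtype else ⊤, ?_, ?_, ?_,
    fun i hi => ?_⟩
  · intro a b hab
    dsimp only
    split_ifs with h₁ h₂
    · exact Submodule.map_mono (hF hab)
    · exact le_top
    · omega
    · exact le_rfl
  · simp [h0]
  · simp
  · suffices H : ∀ U V : Submodule A M, U = (F i).map (LinearMap.ker g).subtype →
        (V = if i + 1 ≤ l then (F (i + 1)).map (LinearMap.ker g).subtype else ⊤) →
        ∃ j, Nonempty ((V ⧸ U.submoduleOf V) ≃ₗ[A] X j) from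
      H _ _ (if_pos (Nat.lt_succ_iff.1 hi)) rfl
    rintro U V rfl hV
    rcases (Nat.lt_succ_iff.1 hi).lt_or_eq with hil | rfl
    · rw [if_pos (Nat.succ_le_of_lt hil)] at hV
      subst hV
      obtain ⟨j, hj⟩ := hs i hil
      obtain ⟨f, hf, hfU⟩ := (nonempty_subquotient_equiv_iff _ _).1 hj
      refine ⟨j, (nonempty_subquotient_equiv_iff _ _).2
        ⟨f ∘ₗ (Submodule.equivSubtypeMap _ (F (i + 1))).symm.toLinearMap,
          hf.comp (LinearEquiv.surjective _), fun x => ?_⟩⟩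
      obtain ⟨y, rfl⟩ := (Submodule.equivSubtypeMap _ (F (i + 1))).surjective x
      rw [LinearMap.comp_apply, LinearEquiv.coe_coe, LinearEquiv.symm_apply_apply]
      exact (hfU y).trans (hmap _ _).symm
    · rw [if_neg (by omega)] at hV
      subst hV
      rw [hl]
      refine ⟨j, (nonempty_subquotient_equiv_iff _ _).2
        ⟨g ∘ₗ Submodule.subtype _, fun d => ?_, fun x => by simp⟩⟩
      obtain ⟨x, rfl⟩ := hg d
      exact ⟨⟨x, trivial⟩, rfl⟩

/-- Induction over the length of a filtration, removing the top subquotient. -/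
theorem Filtered.induction {motive : ∀ (M : Type u) [AddCommGroup M] [Module A M], Prop}
    (zero : ∀ (M : Type u) [AddCommGroup M] [Module A M], Subsingleton M → motive M)
    (step : ∀ (M : Type u) [AddCommGroup M] [Module A M] (j : ι) (g : M →ₗ[A] X j),
      Function.Surjective g → Filtered X (ModuleCat.of A (LinearMap.ker g)) →
      motive (LinearMap.ker g) → motive M)
    {M : Type u} [AddCommGroup M] [Module A M] (h : Filtered X (ModuleCat.of A M)) :
    motive M := by
  obtain ⟨l, F, hF, h0, hl, hs⟩ := h
  change ℕ → Submodule A M at F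
  induction l generalizing M with
  | zero => exact zero M ((Submodule.subsingleton_iff A).1
      (subsingleton_of_bot_eq_top (α := Submodule A M) (h0.symm.trans hl)))
  | succ l ih =>
    obtain ⟨j, hj⟩ := hs l l.lt_succ_self
    obtain ⟨f, hf, hfU⟩ := (nonempty_subquotient_equiv_iff _ _).1 hj
    have htop : ∀ x : M, x ∈ F (l + 1) := fun x => hl ▸ Submodule.mem_top
    let g : M →ₗ[A] X j := f ∘ₗ LinearMap.id.codRestrict (F (l + 1)) htop
    have hg : Function.Surjective g := fun d => by
      obtain ⟨x, rfl⟩ := hf d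
      exact ⟨x, rfl⟩
    have hker : LinearMap.ker g = F l := Submodule.ext fun x => hfU ⟨x, htop x⟩
    have h0' : (F 0).comap (LinearMap.ker g).subtype = ⊥ := by
      rw [h0]
      exact Submodule.ker_subtype _
    have hl' : (F l).comap (LinearMap.ker g).subtype = ⊤ := by
      rw [← hker]
      exact Submodule.comap_subtype_self _
    have hs' : ∀ i < l, ∃ j, Nonempty (((F (i + 1)).comap (LinearMap.ker g).subtype ⧸
        ((F i).comap (LinearMap.ker g).subtype).submoduleOf
          ((F (i + 1)).comap (LinearMap.ker g).subtype)) ≃ₗ[A] X j) := by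
      intro i hi
      obtain ⟨j, hj⟩ := hs i (hi.trans l.lt_succ_self)
      obtain ⟨f, hf, hfU⟩ := (nonempty_subquotient_equiv_iff _ _).1 hj
      refine ⟨j, (nonempty_subquotient_equiv_iff _ _).2
        ⟨f ∘ₗ (LinearMap.ker g).subtype.restrict fun x hx => hx, fun d => ?_, fun x => hfU _⟩⟩
      obtain ⟨⟨y, hy⟩, rfl⟩ := hf d
      exact ⟨⟨⟨y, hker ▸ hF hi hy⟩, hy⟩, rfl⟩
    have hmono : Monotone fun i => (F i).comap (LinearMap.ker g).subtype :=
      fun a b hab => Submodule.comap_mono (hF hab)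
    exact step M j g hg ⟨l, _, hmono, h0', hl', hs'⟩ (ih _ hmono h0' hl' hs')

/-- `𝓕(X)` is closed under extensions. -/
theorem Filtered.of_exact {M₁ M M₂ : Type u} [AddCommGroup M₁] [Module A M₁]
    [AddCommGroup M] [Module A M] [AddCommGroup M₂] [Module A M₂]
    (h₁ : Filtered X (ModuleCat.of A M₁)) (h₂ : Filtered X (ModuleCat.of A M₂))
    (f : M₁ →ₗ[A] M) (hf : Function.Injective f) (g : M →ₗ[A] M₂) (hg : Function.Surjective g)
    (hfg : Function.Exact f g) : Filtered X (ModuleCat.of A M) := by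
  refine Filtered.induction (motive := fun M₂ _ _ => ∀ (M : Type u) [AddCommGroup M] [Module A M]
    (f : M₁ →ₗ[A] M) (_ : Function.Injective f) (g : M →ₗ[A] M₂) (_ : Function.Surjective g)
    (_ : Function.Exact f g), Filtered X (ModuleCat.of A M)) ?_ ?_ h₂ M f hf g hg hfg
  · intro M₂ _ _ _ M _ _ f hf g hg hfg
    refine h₁.of_equiv (LinearEquiv.ofBijective f ⟨hf, fun x => ?_⟩)
    exact (hfg x).1 (Subsingleton.elim _ _)
  · intro M₂ _ _ j p hp _ ih M _ _ f hf g hg hfg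
    refine .of_ker (g := p ∘ₗ g) (hp.comp hg) ?_
    refine ih _ (f.codRestrict _ fun x => ?_) (fun x y hxy => hf (congrArg Subtype.val hxy))
      (g.restrict fun x hx => hx) (fun y => ?_) (fun x => ?_)
    · have : g (f x) = 0 := (hfg _).2 ⟨x, rfl⟩
      simp [this]
    · obtain ⟨x, hx⟩ := hg y
      exact ⟨⟨x, by simp [hx]⟩, Subtype.ext hx⟩
    · refine ⟨fun hx => ?_, ?_⟩
      · obtain ⟨y, hy⟩ := (hfg x).1 (congrArg Subtype.val hx)
        exact ⟨y, Subtype.ext hy⟩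
      · rintro ⟨y, rfl⟩
        exact Subtype.ext ((hfg _).2 ⟨y, rfl⟩)

theorem Filtered.of_extension {M N : Type u} [AddCommGroup M] [Module A M] [AddCommGroup N]
    [Module A N] {g : M →ₗ[A] N} (hg : Function.Surjective g)
    (h₁ : Filtered X (ModuleCat.of A (LinearMap.ker g))) (h₂ : Filtered X (ModuleCat.of A N)) :
    Filtered X (ModuleCat.of A M) :=
  h₁.of_exact h₂ _ (Submodule.subtype_injective _) g hg (LinearMap.exact_subtype_ker_map g)

theorem Filtered.single (j : ι) : Filtered X (ModuleCat.of A (X j)) := by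
  refine .of_ker (g := LinearMap.id (R := A) (M := X j)) Function.surjective_id ?_
  have : Subsingleton (LinearMap.ker (LinearMap.id (R := A) (M := X j))) := by
    rw [LinearMap.ker_id]
    infer_instance
  exact .of_subsingleton _

theorem Filtered.reindex {κ : Type} {Y : κ → ModuleCat.{u} A} {M : Type u} [AddCommGroup M]
    [Module A M] (h : Filtered X (ModuleCat.of A M)) (φ : ι → κ) (hφ : ∀ i, X i = Y (φ i)) :
    Filtered Y (ModuleCat.of A M) := by
  refine Filtered.induction (motive := fun M _ _ => Filtered Y (ModuleCat.of A M)) ?_ ?_ h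
  · intro M _ _ _
    exact .of_subsingleton M
  · intro M _ _ j g hg _ ih
    refine ih.of_extension hg ?_
    rw [hφ j]
    exact .single (φ j)

theorem Filtered.finite {M : Type u} [AddCommGroup M] [Module A M]
    (h : Filtered X (ModuleCat.of A M)) (hX : ∀ i, Module.Finite A (X i)) :
    Module.Finite A M := by
  refine Filtered.induction (motive := fun M _ _ => Module.Finite A M) ?_ ?_ h
  · intro M _ _ _
    infer_instance
  · intro M _ _ j g hg _ ih
    have := hX j
    have := Module.Finite.equiv (g.quotKerEquivOfSurjective hg).symm
    exact .of_submodule_quotient (LinearMap.ker g)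

theorem Filtered.pi {M : Type u} [AddCommGroup M] [Module A M]
    (h : Filtered X (ModuleCat.of A M)) (m : ℕ) : Filtered X (ModuleCat.of A (Fin m → M)) := by
  induction m with
  | zero => exact .of_subsingleton _
  | succ m ih =>
    have e : (M × (Fin m → M)) ≃ₗ[A] (Fin (m + 1) → M) := Fin.consLinearEquiv A fun _ => M
    refine Filtered.of_equiv (h.of_exact ih (LinearMap.inl A M (Fin m → M))
      LinearMap.inl_injective (LinearMap.snd A M _) Prod.snd_surjective
      Function.Exact.inl_snd) e

end Filtrations

namespace SimpleData

variable {A : Type u} [Ring A] {n : ℕ} (S : SimpleData A n)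
variable {M N Y : Type u} [AddCommGroup M] [Module A M] [AddCommGroup N] [Module A N]
  [AddCommGroup Y] [Module A Y]

/-! ### Composition factors and socles over the given labelling -/

section CompositionFactors

variable (M) in
/-- `L(m)` is not a composition factor of `M`, expressed as `Hom(P(m), M) = 0`. -/
def Omits (m : Fin n) : Prop :=
  ∀ f : S.P m →ₗ[A] M, f = 0

instance (i : Fin n) : IsSimpleModule A (S.L i) := S.simple i

instance (i : Fin n) : Module.Projective A (S.P i) := (S.cover i).1

theorem p_surjective (i : Fin n) : Function.Surjective (S.p i) := (S.cover i).2.1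

theorem p_ne_zero (i : Fin n) : S.p i ≠ 0 := fun h => by
  have := IsSimpleModule.nontrivial A (S.L i)
  obtain ⟨x, hx⟩ := exists_ne (0 : S.L i)
  obtain ⟨y, rfl⟩ := S.p_surjective i x
  exact hx (by rw [h, LinearMap.zero_apply])

theorem le_ker_p {i : Fin n} {U : Submodule A (S.P i)} (hU : U ≠ ⊤) :
    U ≤ LinearMap.ker (S.p i) := by
  by_contra h
  refine hU ((S.cover i).2.2 U ?_)
  rcases eq_bot_or_eq_top (U.map (S.p i)) with h' | h'
  · exact absurd (LinearMap.le_ker_iff_map.2 h') h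
  · rw [← Submodule.comap_map_eq, h', Submodule.comap_top]

theorem finite_P (i : Fin n) : Module.Finite A (S.P i) := by
  have := IsSimpleModule.nontrivial A (S.L i)
  obtain ⟨x, hx⟩ := exists_ne (0 : S.L i)
  obtain ⟨y, rfl⟩ := S.p_surjective i x
  have : Submodule.span A {y} = ⊤ := by
    by_contra h
    exact hx (S.le_ker_p h (Submodule.mem_span_singleton_self y))
  exact ⟨⟨{y}, by simpa using this⟩⟩

variable {S}

theorem Omits.of_injective {m : Fin n} (h : S.Omits N m) {f : M →ₗ[A] N}
    (hf : Function.Injective f) : S.Omits M m := fun g => by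
  ext x
  exact hf (by simpa using LinearMap.congr_fun (h (f ∘ₗ g)) x)

theorem Omits.submodule {m : Fin n} (h : S.Omits M m) (U : Submodule A M) : S.Omits U m :=
  h.of_injective U.subtype_injective

theorem Omits.of_surjective {m : Fin n} (h : S.Omits M m) {f : M →ₗ[A] N}
    (hf : Function.Surjective f) : S.Omits N m := fun g => by
  obtain ⟨t, rfl⟩ := Module.projective_lifting_property f g hf
  rw [h t, LinearMap.comp_zero]

theorem Omits.of_extension {m : Fin n} {g : M →ₗ[A] N} (h₁ : S.Omits (LinearMap.ker g) m)
    (h₂ : S.Omits N m) : S.Omits M m := fun f => by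
  have hf : ∀ x, g (f x) = 0 := fun x => LinearMap.congr_fun (h₂ (g ∘ₗ f)) x
  ext x
  exact congrArg Subtype.val (LinearMap.congr_fun (h₁ (f.codRestrict _ hf)) x)

theorem omits_of_subsingleton [Subsingleton M] (m : Fin n) : S.Omits M m :=
  fun _ => LinearMap.ext fun _ => Subsingleton.elim _ _

variable (S)

/-- `L(m)` is a composition factor of `M` if and only if `Hom(M, I(m)) ≠ 0`. -/
theorem omits_iff_forall_I (m : Fin n) : S.Omits M m ↔ ∀ f : M →ₗ[A] S.I m, f = 0 := by
  constructor
  · intro h f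
    by_contra hf
    -- The range of `f` contains the socle `L(m)` of `I(m)`, to which `P(m)` maps.
    have hne : LinearMap.range f ⊓ LinearMap.range (S.j m) ≠ ⊥ := fun h0 =>
      hf (LinearMap.range_eq_bot.1 ((S.envelope m).2.2 _ h0))
    obtain ⟨y, ⟨hyf, ⟨l, rfl⟩⟩, hy0⟩ := Submodule.exists_mem_ne_zero_of_ne_bot hne
    have hcomap : (LinearMap.range f).comap (S.j m) = ⊤ := by
      refine (eq_bot_or_eq_top _).resolve_left fun h0 => ?_
      have : l ∈ (LinearMap.range f).comap (S.j m) := hyf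
      rw [h0, Submodule.mem_bot] at this
      exact hy0 (by rw [this, map_zero])
    have hmem : ∀ x, (S.j m ∘ₗ S.p m) x ∈ LinearMap.range f := fun x => by
      have : S.p m x ∈ (LinearMap.range f).comap (S.j m) := hcomap ▸ Submodule.mem_top
      exact this
    obtain ⟨t, ht⟩ := Module.projective_lifting_property f.rangeRestrict
      ((S.j m ∘ₗ S.p m).codRestrict _ hmem) f.surjective_rangeRestrict
    refine S.p_ne_zero m (LinearMap.ext fun x => (S.envelope m).2.1 ?_)
    have := congrArg Subtype.val (LinearMap.congr_fun ht x)
    rw [h t, LinearMap.comp_zero] at this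
    simpa using this.symm
  · intro h f
    by_contra hf
    have hker : LinearMap.ker f ≤ LinearMap.ker (S.p m) :=
      S.le_ker_p fun h0 => hf (LinearMap.ker_eq_top.1 h0)
    obtain ⟨q, hq⟩ := exists_factor_of_ker_le f.surjective_rangeRestrict (S.p m) (fun x hx =>
      hker (congrArg Subtype.val hx))
    -- The map `range f → L(m) → I(m)` extends to `M`.
    obtain ⟨e, he⟩ := (S.envelope m).1.out _ (Submodule.subtype_injective _) (S.j m ∘ₗ q)
    refine S.p_ne_zero m (LinearMap.ext fun x => (S.envelope m).2.1 ?_)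
    rw [← hq x]
    have := he (f.rangeRestrict x)
    rw [h e] at this
    simpa using this.symm

theorem eq_of_hom_L {i i' : Fin n} {f : S.L i →ₗ[A] S.L i'} (hf : f ≠ 0) : i = i' :=
  S.eq_of_equiv _ _ ⟨LinearEquiv.ofBijective f (LinearMap.bijective_of_ne_zero hf)⟩

theorem omits_L {i m : Fin n} (h : m ≠ i) : S.Omits (S.L i) m := fun f => by
  by_contra hf
  have hker : LinearMap.ker f ≤ LinearMap.ker (S.p m) :=
      S.le_ker_p fun h0 => hf (LinearMap.ker_eq_top.1 h0)
  obtain ⟨q, hq⟩ := exists_factor_of_ker_le (LinearMap.surjective_of_ne_zero hf) (S.p m) hker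
  refine h (S.eq_of_hom_L (f := q) ?_).symm
  rintro rfl
  exact S.p_ne_zero m (LinearMap.ext fun x => (hq x).symm)

theorem not_omits_L (i : Fin n) : ¬ S.Omits (S.L i) i := fun h => S.p_ne_zero i (h (S.p i))

theorem not_omits_of_L_le {m : Fin n} {f : S.L m →ₗ[A] M} (hf : f ≠ 0) : ¬ S.Omits M m :=
  fun h => by
    have hinj := LinearMap.injective_of_ne_zero hf
    exact S.p_ne_zero m ((h.of_injective hinj) (S.p m))

theorem not_omits_of_L_quotient {m : Fin n} {f : M →ₗ[A] S.L m} (hf : f ≠ 0) : ¬ S.Omits M m :=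
  fun h => S.p_ne_zero m ((h.of_surjective (LinearMap.surjective_of_ne_zero hf)) (S.p m))

/-- Over a left artinian ring every nonzero module contains a simple module. -/
theorem exists_L_hom [IsArtinianRing A] [Nontrivial M] :
    ∃ (i : Fin n) (f : S.L i →ₗ[A] M), f ≠ 0 := by
  obtain ⟨x, hx⟩ := exists_ne (0 : M)
  let U := Submodule.span A {x}
  have hU : (⊤ : Submodule A U) ≠ ⊥ := fun h => by
    have : (⟨x, Submodule.mem_span_singleton_self x⟩ : U) ∈ (⊥ : Submodule A U) :=
      h ▸ Submodule.mem_top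
    exact hx (congrArg Subtype.val ((Submodule.mem_bot A).1 this))
  obtain ⟨V, hV, -⟩ := (eq_bot_or_exists_atom_le (⊤ : Submodule A U)).resolve_left hU
  have := isSimpleModule_iff_isAtom.2 hV
  obtain ⟨i, ⟨e⟩⟩ := S.exists_equiv (ModuleCat.of A V) this
  refine ⟨i, U.subtype ∘ₗ V.subtype ∘ₗ e.symm.toLinearMap, fun h => ?_⟩
  have := IsSimpleModule.nontrivial A (S.L i)
  obtain ⟨y, hy⟩ := exists_ne (0 : S.L i)
  refine hy (e.symm.injective (Subtype.ext (Subtype.ext ?_)))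
  simpa using LinearMap.congr_fun h y

theorem exists_hom_L [Module.Finite A M] [Nontrivial M] :
    ∃ (i : Fin n) (f : M →ₗ[A] S.L i), f ≠ 0 := by
  obtain ⟨V, hV, -⟩ := (eq_top_or_exists_le_coatom (⊥ : Submodule A M)).resolve_left bot_ne_top
  have := isSimpleModule_iff_isCoatom.2 hV
  obtain ⟨i, ⟨e⟩⟩ := S.exists_equiv (ModuleCat.of A (M ⧸ V)) this
  refine ⟨i, e.toLinearMap ∘ₗ V.mkQ, fun h => hV.1 (eq_top_iff.2 fun x _ => ?_)⟩
  have : e (V.mkQ x) = 0 := LinearMap.congr_fun h x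
  have := e.map_eq_zero_iff.1 this
  simpa using this

/-- There is no nonzero homomorphism from a module with composition factors `L(s)`, `s < i`, to a
module with socle factors `L(s)`, `s ≥ i`. -/
theorem hom_eq_zero_of_socle [IsArtinianRing A] {i : Fin n} (h₁ : ∀ m, i ≤ m → S.Omits M m)
    (h₂ : ∀ m < i, ∀ f : S.L m →ₗ[A] Y, f = 0) (f : M →ₗ[A] Y) : f = 0 := by
  by_contra hf
  have : Nontrivial (LinearMap.range f) :=
    Submodule.nontrivial_iff_ne_bot.2 fun h => hf (LinearMap.range_eq_bot.1 h)
  obtain ⟨m, g, hg⟩ := S.exists_L_hom (M := LinearMap.range f)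
  rcases lt_or_ge m i with hm | hm
  · refine hg (LinearMap.ext fun x => Subtype.ext ?_)
    exact LinearMap.congr_fun (h₂ m hm ((LinearMap.range f).subtype ∘ₗ g)) x
  · exact S.not_omits_of_L_le hg ((h₁ m hm).of_surjective f.surjective_rangeRestrict)

/-- There is no nonzero homomorphism from a module with top factors `L(s)`, `s ≥ i`, to a module
with composition factors `L(s)`, `s < i`. -/
theorem hom_eq_zero_of_top [Module.Finite A M] {i : Fin n}
    (h₁ : ∀ m < i, ∀ f : M →ₗ[A] S.L m, f = 0)
    (h₂ : ∀ m, i ≤ m → S.Omits Y m) (f : M →ₗ[A] Y) : f = 0 := by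
  by_contra hf
  have : Nontrivial (LinearMap.range f) :=
    Submodule.nontrivial_iff_ne_bot.2 fun h => hf (LinearMap.range_eq_bot.1 h)
  obtain ⟨m, g, hg⟩ := S.exists_hom_L (M := LinearMap.range f)
  rcases lt_or_ge m i with hm | hm
  · refine hg (LinearMap.ext fun ⟨y, x, hx⟩ => ?_)
    subst hx
    exact LinearMap.congr_fun (h₁ m hm (g ∘ₗ f.rangeRestrict)) x
  · exact S.not_omits_of_L_quotient hg ((h₂ m hm).submodule _)

end CompositionFactors

/-! ### Standard modules and traces -/

section Standard

variable (M) in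
/-- The trace of `⨁_{m > i} P(m)` in `M`. -/
def traceGT (i : Fin n) : Submodule A M :=
  ⨆ (m : Fin n) (_ : i < m), traceOf (S.P m) M

variable {S}

theorem range_le_traceGT {i m : Fin n} (h : i < m) (f : S.P m →ₗ[A] M) :
    LinearMap.range f ≤ S.traceGT M i :=
  (le_iSup (fun f : S.P m →ₗ[A] M => LinearMap.range f) f).trans
    (le_iSup₂ (f := fun (m : Fin n) (_ : i < m) => traceOf (S.P m) M) m h)

theorem traceGT_le {i : Fin n} {U : Submodule A M}
    (h : ∀ m, i < m → ∀ f : S.P m →ₗ[A] M, LinearMap.range f ≤ U) : S.traceGT M i ≤ U :=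
  iSup₂_le fun m hm => iSup_le (h m hm)

theorem map_traceGT_le (f : M →ₗ[A] N) (i : Fin n) :
    (S.traceGT M i).map f ≤ S.traceGT N i := by
  rw [Submodule.map_le_iff_le_comap]
  refine traceGT_le fun m hm g => ?_
  rw [← Submodule.map_le_iff_le_comap, ← LinearMap.range_comp]
  exact range_le_traceGT hm _

theorem omits_quotient_traceGT {i m : Fin n} (h : i < m) : S.Omits (M ⧸ S.traceGT M i) m :=
  fun f => by
    obtain ⟨g, rfl⟩ := Module.projective_lifting_property (S.traceGT M i).mkQ f
      (Submodule.mkQ_surjective _)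
    rw [← LinearMap.range_le_ker_iff, Submodule.ker_mkQ]
    exact range_le_traceGT h g

/-- The trace of `⨁_{m > i} P(m)` is generated by images of the `P(m)` with `m > i`. -/
theorem hom_traceGT_eq_zero {i : Fin n} (h : ∀ m, i < m → S.Omits Y m)
    (f : S.traceGT M i →ₗ[A] Y) : f = 0 := by
  have hle : S.traceGT M i ≤ (LinearMap.ker f).map (S.traceGT M i).subtype := by
    refine traceGT_le fun m hm g => ?_
    rintro _ ⟨x, rfl⟩
    have := LinearMap.congr_fun (h m hm (f ∘ₗ g.codRestrict (S.traceGT M i)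
      fun x => range_le_traceGT hm g ⟨x, rfl⟩)) x
    exact ⟨_, this, rfl⟩
  ext x
  obtain ⟨y, hy, hyx⟩ := hle x.2
  rw [← show y = x from Subtype.ext hyx]
  exact hy

variable (S)

/-- The canonical projection `P(i) → Δ(i)`. -/
def toΔ (i : Fin n) : S.P i →ₗ[A] S.Δ i := (S.traceGT (S.P i) i).mkQ

theorem toΔ_surjective (i : Fin n) : Function.Surjective (S.toΔ i) := Submodule.mkQ_surjective _

theorem ker_toΔ (i : Fin n) : LinearMap.ker (S.toΔ i) = S.traceGT (S.P i) i :=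
  Submodule.ker_mkQ _

theorem omits_Δ {i m : Fin n} (h : i < m) : S.Omits (S.Δ i) m :=
  omits_quotient_traceGT h

theorem finite_Δ (i : Fin n) : Module.Finite A (S.Δ i) := by
  have := S.finite_P i
  exact .of_surjective _ (S.toΔ_surjective i)

/-- The projection `P(i) → L(i)` factors through `Δ(i)`. -/
theorem exists_Δ_to_L (i : Fin n) : ∃ q : S.Δ i →ₗ[A] S.L i, ∀ x, q (S.toΔ i x) = S.p i x := by
  refine exists_factor_of_ker_le (S.toΔ_surjective i) (S.p i) fun x hx => ?_
  have hle : S.traceGT (S.P i) i ≤ LinearMap.ker (S.p i) := by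
    refine traceGT_le fun m hm f => ?_
    rw [LinearMap.range_le_ker_iff]
    exact S.omits_L hm.ne' _
  exact hle ((S.ker_toΔ i) ▸ hx)

/-- `Ext¹(Δ(i), Y) = 0` if no composition factor `L(m)` of `Y` has `m > i`. -/
theorem extVanishes_Δ_of_omits {i : Fin n} (h : ∀ m, i < m → S.Omits Y m) :
    ExtVanishes A (S.Δ i) Y := by
  refine .of_presentation (S.toΔ_surjective i) fun f => ⟨0, fun x => ?_⟩
  revert f x
  rw [S.ker_toΔ i]
  intro f x
  rw [hom_traceGT_eq_zero h f]
  rfl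

end Standard

/-! ### Proper costandard modules -/

section ProperCostandard

theorem exists_extension_I (i : Fin n) {f : M →ₗ[A] N} (hf : Function.Injective f)
    (h : M →ₗ[A] S.I i) : ∃ h' : N →ₗ[A] S.I i, ∀ x, h' (f x) = h x :=
  (S.envelope i).1.out f hf h

theorem omits_reject (i : Fin n) : S.Omits (rejectOf (A := A) M (S.I i)) i := by
  rw [S.omits_iff_forall_I]
  intro f
  obtain ⟨e, he⟩ := S.exists_extension_I i (Submodule.subtype_injective _) f
  ext x
  rw [← he]
  exact (Submodule.mem_iInf _).1 x.2 e

theorem omits_costd {i m : Fin n} (h : i < m) : S.Omits (S.costd i) m := by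
  refine (S.omits_reject m (M := S.I i)).of_injective (Submodule.inclusion_injective
    (p := S.costd i) ?_)
  exact iInf₂_le (f := fun (m : Fin n) (_ : i < m) => rejectOf (S.I i) (S.I m)) m h

theorem le_costd_of_omits {i : Fin n} {V : Submodule A (S.I i)}
    (h : ∀ m, i < m → S.Omits V m) : V ≤ S.costd i := by
  refine le_iInf₂ fun m hm => le_iInf fun f x hx => ?_
  exact LinearMap.congr_fun ((S.omits_iff_forall_I m).1 (h m hm) (f ∘ₗ V.subtype)) ⟨x, hx⟩

/-- The inclusion of the socle `L(i)` in the costandard module `∇(i)`. -/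
def LToCostd (i : Fin n) : S.L i →ₗ[A] S.costd i :=
  (S.j i).codRestrict _ fun x => by
    refine S.le_costd_of_omits (V := LinearMap.range (S.j i)) (fun m hm => ?_) ⟨x, rfl⟩
    exact (S.omits_L hm.ne').of_surjective (S.j i).surjective_rangeRestrict

theorem LToCostd_injective (i : Fin n) : Function.Injective (S.LToCostd i) :=
  fun _ _ h => (S.envelope i).2.1 (congrArg Subtype.val h)

theorem socle_costd (i : Fin n) : socle A (S.costd i) = LinearMap.range (S.LToCostd i) := by
  refine le_antisymm (sSup_le fun V hV => ?_) (le_sSup ?_)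
  · have hV : IsSimpleModule A V := hV
    have hatom := isSimpleModule_iff_isAtom.1 hV
    have hne : V.map (S.costd i).subtype ⊓ LinearMap.range (S.j i) ≠ ⊥ := fun h =>
      hatom.1 (le_bot_iff.1 ((LinearMap.le_ker_iff_map.2 ((S.envelope i).2.2 _ h)).trans
        (Submodule.ker_subtype _).le))
    obtain ⟨_, ⟨⟨y, hy, rfl⟩, ⟨l, hl⟩⟩, h0⟩ := Submodule.exists_mem_ne_zero_of_ne_bot hne
    have hyl : S.LToCostd i l = y := Subtype.ext hl
    refine inf_eq_left.1 ((hatom.le_iff.1 inf_le_left).resolve_left fun h => h0 ?_)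
    have : y ∈ V ⊓ LinearMap.range (S.LToCostd i) := ⟨hy, l, hyl⟩
    rw [h, Submodule.mem_bot] at this
    rw [this, map_zero]
  · exact IsSimpleModule.congr (LinearEquiv.ofInjective _ (S.LToCostd_injective i)).symm

/-- The inclusion of the proper costandard module `∇̄(i)` in `I(i)`. -/
noncomputable def properCostdToI (i : Fin n) : S.properCostd i →ₗ[A] S.I i :=
  (S.costd i).subtype ∘ₗ Submodule.subtype _

theorem properCostdToI_injective (i : Fin n) : Function.Injective (S.properCostdToI i) :=
  (Submodule.subtype_injective _).comp (Submodule.subtype_injective _)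

theorem omits_properCostd {i m : Fin n} (h : i < m) : S.Omits (S.properCostd i) m :=
  (S.omits_costd h).submodule _

/-- The inclusion of the socle `L(i)` in the proper costandard module `∇̄(i)`. -/
noncomputable def LToProperCostd (i : Fin n) : S.L i →ₗ[A] S.properCostd i :=
  (S.LToCostd i).codRestrict _ fun x => by
    have : (socle A (S.costd i)).mkQ (S.LToCostd i x) = 0 := by
      rw [Submodule.mkQ_apply, Submodule.Quotient.mk_eq_zero, S.socle_costd]
      exact ⟨x, rfl⟩
    rw [Submodule.mem_comap, this]
    exact zero_mem _

theorem LToProperCostd_injective (i : Fin n) : Function.Injective (S.LToProperCostd i) :=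
  fun _ _ h => S.LToCostd_injective i (congrArg Subtype.val h)

/-- A homomorphism from `∇̄(i)` is injective if it is so on the socle `L(i)`, which meets every
nonzero submodule. -/
theorem injective_of_comp_LToProperCostd {i : Fin n} {f : S.properCostd i →ₗ[A] M}
    (hf : Function.Injective (f ∘ₗ S.LToProperCostd i)) : Function.Injective f := by
  rw [← LinearMap.ker_eq_bot]
  have hinj := LinearMap.ker_eq_bot.2 (S.properCostdToI_injective i)
  refine le_bot_iff.1 ((LinearMap.le_ker_iff_map.2
    ((S.envelope i).2.2 _ (le_bot_iff.1 ?_))).trans hinj.le)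
  rintro _ ⟨⟨y, hy, rfl⟩, ⟨l, hl⟩⟩
  have hyl : S.LToProperCostd i l = y := S.properCostdToI_injective i hl
  have hl0 : l = 0 := hf (by
    rw [map_zero, LinearMap.comp_apply, hyl]
    exact hy)
  rw [← hyl, hl0, map_zero, map_zero]
  exact zero_mem _

/-- Only factors `L(s)` with `s < i` occur in `∇̄(i) / L(i)`. -/
theorem omits_properCostd_quotient {i m : Fin n} (h : i ≤ m) :
    S.Omits (S.properCostd i ⧸ LinearMap.range (S.LToProperCostd i)) m := by
  rcases h.lt_or_eq with h | rfl
  · exact (S.omits_properCostd h).of_surjective (Submodule.mkQ_surjective _)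
  let ψ : S.properCostd i →ₗ[A] rejectOf (S.costd i ⧸ socle A (S.costd i)) (S.I i) :=
    (socle A (S.costd i)).mkQ.restrict fun x hx => hx
  have hψ : LinearMap.ker ψ = LinearMap.range (S.LToProperCostd i) := by
    ext x
    have : x ∈ LinearMap.ker ψ ↔ x.1 ∈ socle A (S.costd i) := by
      rw [← Submodule.Quotient.mk_eq_zero (socle A (S.costd i))]
      exact Subtype.ext_iff
    refine this.trans ⟨fun hx => ?_, fun ⟨l, hl⟩ => ?_⟩
    · obtain ⟨l, hl⟩ := (S.socle_costd i).le hx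
      exact ⟨l, Subtype.ext hl⟩
    · exact (S.socle_costd i).ge ⟨l, congrArg Subtype.val hl⟩
  refine (S.omits_reject i).of_injective
    (f := (LinearMap.range (S.LToProperCostd i)).liftQ ψ hψ.ge) ?_
  rw [← LinearMap.ker_eq_bot]
  exact Submodule.ker_liftQ_eq_bot _ _ _ hψ.le

/-- `∇̄(i)` is the largest submodule of `I(i)` containing `L(i)` for which only factors `L(s)` with
`s < i` occur in the quotient by `L(i)`; so the socle factors of `I(i) / ∇̄(i)` are among the
`L(s)` with `s ≥ i`. -/
theorem hom_I_quotient_eq_zero {i : Fin n} (h : ∀ m, i ≤ m → S.Omits M m)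
    (f : M →ₗ[A] S.I i ⧸ LinearMap.range (S.properCostdToI i)) : f = 0 := by
  let K := LinearMap.range (S.properCostdToI i)
  let V : Submodule A (S.I i) := (LinearMap.range f).comap K.mkQ
  have hfr : ∀ m, i ≤ m → S.Omits (LinearMap.range f) m := fun m hm =>
    (h m hm).of_surjective f.surjective_rangeRestrict
  let q : V →ₗ[A] LinearMap.range f := K.mkQ.restrict fun x hx => hx
  have hq : Function.Surjective q := fun ⟨y, hy⟩ => by
    obtain ⟨x, rfl⟩ := Submodule.mkQ_surjective K y
    exact ⟨⟨x, hy⟩, rfl⟩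
  have hqker : ∀ x, q x = 0 → (x : S.I i) ∈ K := fun x hx => by
    rw [← Submodule.Quotient.mk_eq_zero K]
    exact congrArg Subtype.val hx
  have hV : V ≤ S.costd i := S.le_costd_of_omits fun m hm => by
    refine Omits.of_extension (g := q) ?_ (hfr m hm.le)
    obtain ⟨t, ht⟩ := exists_lift_of_injective (S.properCostdToI_injective i)
      (V.subtype ∘ₗ (LinearMap.ker q).subtype) fun x => hqker x x.2
    refine (S.omits_properCostd hm).of_injective (f := t) fun x y hxy => ?_
    have := ht x
    rw [hxy, ht y] at this
    exact Subtype.ext (Subtype.ext this.symm)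
  have hVK : V ≤ K := fun x hx => by
    suffices hr : (socle A (S.costd i)).mkQ ⟨x, hV hx⟩ ∈
        rejectOf (S.costd i ⧸ socle A (S.costd i)) (S.I i) from ⟨⟨⟨x, hV hx⟩, hr⟩, rfl⟩
    refine (Submodule.mem_iInf _).2 fun e => ?_
    -- `e` vanishes on `∇̄(i)`, so on `V` it factors through `V / ∇̄(i) = range f`.
    obtain ⟨e', he'⟩ := exists_factor_of_ker_le hq
      (e ∘ₗ (socle A (S.costd i)).mkQ ∘ₗ Submodule.inclusion hV) fun y hy => by
        obtain ⟨z, hz⟩ := hqker y hy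
        have hz' : Submodule.inclusion hV y = z.1 := Subtype.ext hz.symm
        rw [LinearMap.comp_apply, LinearMap.comp_apply, hz']
        exact (Submodule.mem_iInf _).1 z.2 e
    have := he' ⟨x, hx⟩
    rw [(S.omits_iff_forall_I i).1 (hfr i le_rfl) e'] at this
    exact this.symm
  ext x
  obtain ⟨y, hy⟩ := Submodule.mkQ_surjective K (f x)
  have : y ∈ K := hVK ⟨x, hy.symm⟩
  rw [← hy]
  exact (Submodule.Quotient.mk_eq_zero K).2 this

/-- `Ext¹(Δ(j), ∇̄(i)) = 0`. -/
theorem extVanishes_Δ_properCostd (j i : Fin n) :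
    ExtVanishes A (S.Δ j) (S.properCostd i) := by
  rcases le_or_gt i j with h | h
  · exact S.extVanishes_Δ_of_omits fun m hm => S.omits_properCostd (h.trans_lt hm)
  refine .of_injective (S.properCostdToI_injective i)
    (S.hom_I_quotient_eq_zero fun m hm => S.omits_Δ (h.trans_le hm)) fun N _ _ g hg f => ?_
  exact S.exists_extension_I i (Submodule.subtype_injective _) f

/-- The injective envelopes of simple modules over a finite-dimensional algebra are
finite-dimensional: extending a nonzero functional on `L(i)` to `I(i)` embeds `I(i)` in the dual of
`A`. -/
theorem finite_I (k : Type v) [Field k] [Algebra k A] [FiniteDimensional k A] (i : Fin n) :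
    Module.Finite A (S.I i) := by
  let _ : Module k (S.I i) := Module.compHom _ (algebraMap k A)
  have : IsScalarTower k A (S.I i) := ⟨fun c a x => by
    rw [Algebra.smul_def, mul_smul]
    rfl⟩
  have := IsSimpleModule.nontrivial A (S.L i)
  obtain ⟨l, hl⟩ := exists_ne (0 : S.L i)
  have hl' : S.j i l ≠ 0 := fun h => hl ((S.envelope i).2.1 (h.trans (map_zero _).symm))
  obtain ⟨φ, hφ⟩ := Module.Projective.exists_dual_ne_zero k hl'
  let Θ : S.I i →ₗ[k] A →ₗ[k] k := LinearMap.mk₂ k (fun x a => φ (a • x))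
    (fun x y a => by rw [smul_add, map_add])
    (fun c x a => by rw [smul_comm, map_smul])
    (fun x a b => by rw [add_smul, map_add])
    (fun c x a => by rw [smul_assoc, map_smul])
  let U : Submodule A (S.I i) :=
    { carrier := {x | ∀ a : A, φ (a • x) = 0}
      add_mem' := fun hx hy a => by rw [smul_add, map_add, hx a, hy a, add_zero]
      zero_mem' := fun a => by rw [smul_zero, map_zero]
      smul_mem' := fun b x hx a => by
        rw [← mul_smul]
        exact hx (a * b) }
  have hcomap : U.comap (S.j i) = ⊥ := by
    refine (eq_bot_or_eq_top _).resolve_right fun h => hφ ?_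
    have : l ∈ U.comap (S.j i) := h ▸ Submodule.mem_top
    simpa using this 1
  have hU : U = ⊥ := (S.envelope i).2.2 U (le_bot_iff.1 (by
    rintro _ ⟨hx, ⟨y, rfl⟩⟩
    have hy : y ∈ U.comap (S.j i) := hx
    rw [hcomap, Submodule.mem_bot] at hy
    rw [hy, map_zero]
    exact zero_mem _))
  have hΘ : Function.Injective Θ := by
    rw [injective_iff_map_eq_zero]
    intro x hx
    have : x ∈ U := fun a => LinearMap.congr_fun hx a
    rwa [hU, Submodule.mem_bot] at this
  have := Module.Finite.of_injective Θ hΘ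
  exact Module.Finite.of_restrictScalars_finite k A _

theorem finite_properCostd (k : Type v) [Field k] [Algebra k A] [FiniteDimensional k A]
    (i : Fin n) : Module.Finite A (S.properCostd i) := by
  have := IsArtinianRing.of_finite k A
  have := S.finite_I k i
  exact Module.Finite.of_injective _ (S.properCostdToI_injective i)

end ProperCostandard

/-! ### Syzygies of standard modules -/

section Syzygies

/-- For `j > i` and a surjection `g : M → Δ(j)`, the trace of the `P(m)`, `m > i`, in `M` meets
`ker g` in the corresponding trace in `ker g`. Modulo the latter the extension `M` of `Δ(j)` by
`ker g` splits, since `Ext¹(Δ(j), L(m)) = 0` for `m ≤ i`. -/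
theorem mem_map_traceGT_ker {i j : Fin n} (hij : i < j) {g : M →ₗ[A] S.Δ j}
    (hg : Function.Surjective g) {x : M} (hx : x ∈ S.traceGT M i) (hgx : g x = 0) :
    x ∈ (S.traceGT (LinearMap.ker g) i).map (LinearMap.ker g).subtype := by
  let U := (S.traceGT (LinearMap.ker g) i).map (LinearMap.ker g).subtype
  have hU : U ≤ LinearMap.ker g := by
    rintro _ ⟨y, -, rfl⟩
    exact y.2
  let φ : (M ⧸ U) →ₗ[A] S.Δ j := U.liftQ g hU
  have hφ : Function.Surjective φ := fun d => by
    obtain ⟨y, rfl⟩ := hg d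
    exact ⟨U.mkQ y, rfl⟩
  have homits : ∀ m, i < m → S.Omits (LinearMap.ker φ) m := fun m hm f => by
    obtain ⟨t, ht⟩ := Module.projective_lifting_property U.mkQ ((LinearMap.ker φ).subtype ∘ₗ f)
      (Submodule.mkQ_surjective _)
    have ht' : ∀ y, U.mkQ (t y) = f y := LinearMap.congr_fun ht
    have htg : ∀ y, g (t y) = 0 := fun y => by
      have : φ (U.mkQ (t y)) = 0 := by
        rw [ht']
        exact (f y).2
      exact this
    ext y
    rw [← ht', LinearMap.zero_apply]
    refine (Submodule.Quotient.mk_eq_zero U).2 ⟨⟨t y, htg y⟩, ?_, rfl⟩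
    exact range_le_traceGT hm (t.codRestrict (LinearMap.ker g) htg) ⟨y, rfl⟩
  obtain ⟨s, hs⟩ := (S.extVanishes_Δ_of_omits fun m hm => homits m (hij.trans hm)).exists_lift hφ
    LinearMap.id
  have hle : S.traceGT M i ≤ LinearMap.eqLocus U.mkQ (s ∘ₗ g) := by
    refine traceGT_le fun m hm f => ?_
    rintro _ ⟨y, rfl⟩
    have hmem : ∀ y, (U.mkQ ∘ₗ f - s ∘ₗ g ∘ₗ f) y ∈ LinearMap.ker φ := fun y => by
      have : φ (U.mkQ (f y)) = g (f y) := rfl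
      simp only [LinearMap.mem_ker, LinearMap.sub_apply, LinearMap.comp_apply, map_sub, hs, this,
        LinearMap.id_apply, sub_self]
    have := LinearMap.congr_fun (homits m hm (LinearMap.codRestrict _ _ hmem)) y
    exact sub_eq_zero.1 (congrArg Subtype.val this)
  have hxU : U.mkQ x = s (g x) := hle hx
  rw [hgx, map_zero] at hxU
  exact (Submodule.Quotient.mk_eq_zero U).1 hxU

theorem extVanishes_traceGT (h : Filtered S.Δ (ModuleCat.of A M))
    (hY : ∀ j, ExtVanishes A (S.Δ j) Y) (i : Fin n) : ExtVanishes A (S.traceGT M i) Y := by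
  refine Filtered.induction (motive := fun M _ _ => ExtVanishes A (S.traceGT M i) Y) ?_ ?_ h
  · intro M _ _ _
    exact .of_projective
  · intro M _ _ j g hg _ ih
    let w : S.traceGT (LinearMap.ker g) i →ₗ[A] S.traceGT M i :=
      (LinearMap.ker g).subtype.restrict fun x hx => map_traceGT_le _ i ⟨x, hx, rfl⟩
    have hw : Function.Injective w := fun x y hxy =>
      Subtype.ext (Subtype.ext (congrArg (fun z : S.traceGT M i => (z : M)) hxy))
    rcases le_or_gt j i with hji | hij
    · refine ih.congr_left (LinearEquiv.ofBijective w ⟨hw, ?_⟩)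
      have hle : S.traceGT M i ≤
          (S.traceGT (LinearMap.ker g) i).map (LinearMap.ker g).subtype := by
        refine traceGT_le fun m hm f => ?_
        have hf : ∀ y, g (f y) = 0 :=
          LinearMap.congr_fun (S.omits_Δ (hji.trans_lt hm) (g ∘ₗ f))
        rintro _ ⟨y, rfl⟩
        exact ⟨⟨f y, hf y⟩,
          range_le_traceGT hm (f.codRestrict (LinearMap.ker g) hf) ⟨y, rfl⟩, rfl⟩
      intro x
      obtain ⟨y, hy, hyx⟩ := hle x.2
      exact ⟨⟨y, hy⟩, Subtype.ext hyx⟩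
    · let gT : S.traceGT M i →ₗ[A] S.Δ j := g ∘ₗ Submodule.subtype _
      have hgT : Function.Surjective gT := fun d => by
        obtain ⟨y, rfl⟩ := S.toΔ_surjective j d
        obtain ⟨t, ht⟩ := Module.projective_lifting_property g (S.toΔ j) hg
        exact ⟨⟨t y, range_le_traceGT hij t ⟨y, rfl⟩⟩, LinearMap.congr_fun ht y⟩
      refine .of_extension hgT (ih.congr_left (LinearEquiv.ofBijective
        (w.codRestrict (LinearMap.ker gT) fun x => x.1.2)
        ⟨fun x y hxy => hw (congrArg Subtype.val hxy), fun x => ?_⟩)) (hY j)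
      obtain ⟨y, hy, hyx⟩ := S.mem_map_traceGT_ker hij hg x.1.2 x.2
      exact ⟨⟨y, hy⟩, Subtype.ext (Subtype.ext hyx)⟩

/-- `Ext²(Δ(i), ∇̄(j)) = 0` for an SSS-algebra: the syzygy of `Δ(i)` is a trace in `P(i)`, hence a
direct summand of a trace in `A`. -/
theorem IsSSS.extVanishes_ker_toΔ {S : SimpleData A n} (hA : S.IsSSS) (i j : Fin n) :
    ExtVanishes A (LinearMap.ker (S.toΔ i)) (S.properCostd j) := by
  rw [S.ker_toΔ]
  have := IsSimpleModule.nontrivial A (S.L i)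
  obtain ⟨x, hx⟩ := exists_ne (0 : S.L i)
  obtain ⟨y, rfl⟩ := S.p_surjective i x
  let q : A →ₗ[A] S.P i := LinearMap.toSpanSingleton A _ y
  have hq : Function.Surjective q := by
    rw [← LinearMap.range_eq_top]
    by_contra h
    exact hx (S.le_ker_p h ⟨1, one_smul A y⟩)
  obtain ⟨s, hs⟩ := Module.projective_lifting_property q LinearMap.id hq
  refine (S.extVanishes_traceGT hA (fun m => S.extVanishes_Δ_properCostd m j) i).of_retract
    (s.restrict fun x hx => map_traceGT_le s i ⟨x, hx, rfl⟩)
    (q.restrict fun x hx => map_traceGT_le q i ⟨x, hx, rfl⟩) fun x => Subtype.ext ?_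
  exact LinearMap.congr_fun hs x

end Syzygies

/-! ### Modules orthogonal to standard or proper costandard modules -/

section Orthogonality

variable {S}

theorem exists_minimal_index {p : Fin n → Prop} (h : ∃ i, p i) : ∃ i, p i ∧ ∀ m < i, ¬ p m := by
  obtain ⟨i, hi, hmin⟩ := WellFounded.has_min (wellFounded_lt (α := Fin n)) {i | p i} h
  exact ⟨i, hi, fun m hm hp => hmin m hp hm⟩

theorem isFiniteLength_of_finite [IsArtinianRing A] (M : Type u) [AddCommGroup M] [Module A M]
    [Module.Finite A M] : IsFiniteLength A M :=
  isFiniteLength_iff_isNoetherian_isArtinian.2 ⟨inferInstance, inferInstance⟩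

theorem extVanishes_of_simple_right (hN : IsFiniteLength A N)
    (h : ∀ m, ¬ S.Omits N m → ExtVanishes A M (S.L m)) : ExtVanishes A M N := by
  induction hN with
  | of_subsingleton =>
    exact fun _ _ _ _ _ h => ⟨0, fun x => Subsingleton.elim _ _⟩
  | @of_simple_quotient N _ _ N' _ _ ih =>
    obtain ⟨m, ⟨e⟩⟩ := S.exists_equiv (ModuleCat.of A (N ⧸ N')) ‹_›
    refine .of_extension_right (Submodule.mkQ_surjective N') ?_ ((h m fun hm => ?_).congr_right
      e.symm)
    · rw [Submodule.ker_mkQ]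
      exact ih fun m hm => h m fun hm' => hm (hm'.submodule N')
    · exact S.not_omits_L m
        ((hm.of_surjective (Submodule.mkQ_surjective N')).of_surjective e.surjective)

theorem extVanishes_of_simple_left (hN : IsFiniteLength A N)
    (h : ∀ m, ¬ S.Omits N m → ExtVanishes A (S.L m) Y) : ExtVanishes A N Y := by
  induction hN with
  | of_subsingleton => exact .of_projective
  | @of_simple_quotient N _ _ N' _ _ ih =>
    obtain ⟨m, ⟨e⟩⟩ := S.exists_equiv (ModuleCat.of A (N ⧸ N')) ‹_›
    refine .of_extension (Submodule.mkQ_surjective N') ?_ ((h m fun hm => ?_).congr_left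
      e.symm)
    · rw [Submodule.ker_mkQ]
      exact ih fun m hm => h m fun hm' => hm (hm'.submodule N')
    · exact S.not_omits_L m
        ((hm.of_surjective (Submodule.mkQ_surjective N')).of_surjective e.surjective)

/-- A homomorphism to `Δ(i)` whose composition with `Δ(i) → L(i)` is nonzero is surjective. -/
theorem surjective_of_comp_ne_zero {i : Fin n} {q : S.Δ i →ₗ[A] S.L i}
    (hq : ∀ x, q (S.toΔ i x) = S.p i x) {t : M →ₗ[A] S.Δ i} (ht : q ∘ₗ t ≠ 0) :
    Function.Surjective t := by
  have hU : (LinearMap.range t).comap (S.toΔ i) = ⊤ := by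
    by_contra hU
    refine ht (LinearMap.ext fun x => ?_)
    obtain ⟨y, hy⟩ := S.toΔ_surjective i (t x)
    have : y ∈ LinearMap.ker (S.p i) := S.le_ker_p hU ⟨x, hy.symm⟩
    rw [LinearMap.comp_apply, ← hy, hq]
    exact this
  intro d
  obtain ⟨y, rfl⟩ := S.toΔ_surjective i d
  have : y ∈ (LinearMap.range t).comap (S.toΔ i) := hU ▸ Submodule.mem_top
  exact this

/-- Over an SSS-algebra, `𝓕(Δ)` contains every finite module `M` with `Ext¹(M, ∇̄(i)) = 0` for all
`i`. For the smallest `i` such that `L(i)` is a quotient of `M`, also `Δ(i)` is one. -/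
theorem IsSSS.filtered_Δ [IsArtinianRing A] (hA : S.IsSSS) [Module.Finite A M]
    (hM : ∀ i, ExtVanishes A M (S.properCostd i)) : Filtered S.Δ (ModuleCat.of A M) := by
  obtain ⟨l, hl⟩ : ∃ l, Module.length A M = l := ⟨_, rfl⟩
  induction l using WellFoundedLT.induction generalizing M with
  | _ l IH =>
  rcases subsingleton_or_nontrivial M with hs | hs
  · exact .of_subsingleton M
  obtain ⟨i, ⟨f, hf⟩, hmin⟩ := exists_minimal_index (S.exists_hom_L (M := M))
  have htop : ∀ m < i, ∀ f : M →ₗ[A] S.L m, f = 0 := fun m hm f => by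
    by_contra h
    exact hmin m hm ⟨f, h⟩
  have hL : ∀ m ≤ i, ExtVanishes A M (S.L m) := fun m hm =>
    .of_injective (S.LToProperCostd_injective m) (S.hom_eq_zero_of_top
      (fun s hs => htop s (hs.trans_le hm)) fun s hs => S.omits_properCostd_quotient hs) (hM m)
  obtain ⟨q, hq⟩ := S.exists_Δ_to_L i
  have hqs : Function.Surjective q := fun x => by
    obtain ⟨y, rfl⟩ := S.p_surjective i x
    exact ⟨S.toΔ i y, hq y⟩
  have := S.finite_Δ i
  obtain ⟨t, ht⟩ := (extVanishes_of_simple_right (S := S)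
    (isFiniteLength_of_finite (A := A) (LinearMap.ker q)) fun m hm => hL m (by
      by_contra h
      exact hm ((S.omits_Δ (not_le.1 h)).submodule _))).exists_lift hqs f
  have hts : Function.Surjective t := surjective_of_comp_ne_zero hq fun h => hf (by
    rw [← h]
    exact LinearMap.ext fun x => (ht x).symm)
  refine .of_ker hts (IH _ ?_ (fun j => ?_) rfl)
  · rw [← hl]
    refine Submodule.length_lt fun h => hf ?_
    ext x
    have : x ∈ LinearMap.ker t := h ▸ Submodule.mem_top
    rw [← ht, LinearMap.mem_ker.1 this, map_zero, LinearMap.zero_apply]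
  · exact .ker_of_syzygy (S.toΔ_surjective i) hts (hA.extVanishes_ker_toΔ i j) (hM j)

/-- Over an SSS-algebra, `𝓕(∇̄)` contains every finite module `Y` with `Ext¹(Δ(i), Y) = 0` for all
`i`. For the smallest `i` such that `L(i)` is a submodule of `Y`, also `∇̄(i)` is one. -/
theorem IsSSS.filtered_properCostd [IsArtinianRing A] (hA : S.IsSSS)
    (hfin : ∀ i, Module.Finite A (S.properCostd i)) [Module.Finite A Y]
    (hY : ∀ i, ExtVanishes A (S.Δ i) Y) :
    Filtered S.properCostd (ModuleCat.of A Y) := by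
  obtain ⟨l, hl⟩ : ∃ l, Module.length A Y = l := ⟨_, rfl⟩
  induction l using WellFoundedLT.induction generalizing Y with
  | _ l IH =>
  rcases subsingleton_or_nontrivial Y with hs | hs
  · exact .of_subsingleton Y
  obtain ⟨i, ⟨f, hf⟩, hmin⟩ := exists_minimal_index (S.exists_L_hom (M := Y))
  have hsoc : ∀ m < i, ∀ f : S.L m →ₗ[A] Y, f = 0 := fun m hm f => by
    by_contra h
    exact hmin m hm ⟨f, h⟩
  have hL : ∀ m < i, ExtVanishes A (S.L m) Y := fun m hm => by
    obtain ⟨q, hq⟩ := S.exists_Δ_to_L m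
    have hqs : Function.Surjective q := fun x => by
      obtain ⟨y, rfl⟩ := S.p_surjective m x
      exact ⟨S.toΔ m y, hq y⟩
    exact .of_quotient hqs (S.hom_eq_zero_of_socle
      (fun s hs => (S.omits_Δ (hm.trans_le hs)).submodule _) hsoc) (hY m)
  obtain ⟨e, he⟩ := (extVanishes_of_simple_left (S := S)
    (isFiniteLength_of_finite (A := A) (S.properCostd i ⧸ LinearMap.range (S.LToProperCostd i)))
    fun m hm => hL m (by
      by_contra h
      exact hm (S.omits_properCostd_quotient (not_lt.1 h)))).exists_extension
    (S.LToProperCostd_injective i) (Submodule.mkQ_surjective _)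
    (LinearMap.exact_map_mkQ_range _) f
  have hef : e ∘ₗ S.LToProperCostd i = f := LinearMap.ext he
  have hinj : Function.Injective e := S.injective_of_comp_LToProperCostd (by
    rw [hef]
    exact LinearMap.injective_of_ne_zero hf)
  refine Filtered.of_exact (.single i) (IH _ ?_ (fun j => ?_) rfl) e hinj
    (LinearMap.range e).mkQ (Submodule.mkQ_surjective _) (LinearMap.exact_map_mkQ_range _)
  · rw [← hl]
    refine Submodule.length_quotient_lt _ fun h => hf ?_
    rw [← hef, LinearMap.range_eq_bot.1 h, LinearMap.zero_comp]
  · refine .of_quotient_right (S.toΔ_surjective j) (Submodule.mkQ_surjective _) ?_ (hY j)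
    rw [Submodule.ker_mkQ]
    exact (hA.extVanishes_ker_toΔ j i).congr_right (LinearEquiv.ofInjective e hinj)

end Orthogonality

end SimpleData

/-! ### Universal extensions -/

section UniversalExtensions

variable {A : Type u} [Ring A]
variable {X D P : Type u} [AddCommGroup X] [Module A X] [AddCommGroup D] [Module A D]
  [AddCommGroup P] [Module A P]

/-- Pushout of `0 → ker π → P → D → 0` along a homomorphism `f : ker π → X`. -/
theorem exists_pushout_extension {π : P →ₗ[A] D} (hπ : Function.Surjective π)
    (f : LinearMap.ker π →ₗ[A] X) :
    ∃ (X' : ModuleCat.{u} A) (ι : X →ₗ[A] X') (g : X' →ₗ[A] D) (e : P →ₗ[A] X'),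
      Function.Injective ι ∧ Function.Surjective g ∧ Function.Exact ι g ∧
      ∀ x : LinearMap.ker π, e x = ι (f x) := by
  let σ : LinearMap.ker π →ₗ[A] X × P := f.prod (-(LinearMap.ker π).subtype)
  let W := LinearMap.range σ
  have hmk : ∀ z : X × P, W.mkQ z = 0 ↔ z ∈ W := fun z => Submodule.Quotient.mk_eq_zero W
  refine ⟨ModuleCat.of A ((X × P) ⧸ W), W.mkQ ∘ₗ LinearMap.inl A X P,
    W.liftQ (π ∘ₗ LinearMap.snd A X P) ?_, W.mkQ ∘ₗ LinearMap.inr A X P, ?_, ?_, ?_, ?_⟩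
  · rintro _ ⟨x, rfl⟩
    have : π x = 0 := x.2
    simp [σ, this]
  · rw [injective_iff_map_eq_zero]
    intro x hx
    obtain ⟨y, hy⟩ := (hmk _).1 hx
    have hy2 : -(y : P) = 0 := congrArg Prod.snd hy
    have hy0 : y = 0 := Subtype.ext (neg_eq_zero.1 hy2)
    have hy1 : f y = x := congrArg Prod.fst hy
    rw [← hy1, hy0, map_zero]
  · intro d
    obtain ⟨p, rfl⟩ := hπ d
    exact ⟨W.mkQ (0, p), rfl⟩
  · intro z
    obtain ⟨⟨x, p⟩, rfl⟩ := Submodule.mkQ_surjective W z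
    constructor
    · intro h
      have hp : π p = 0 := h
      refine ⟨x + f ⟨p, hp⟩, sub_eq_zero.1 ?_⟩
      rw [LinearMap.comp_apply, ← map_sub, hmk]
      exact ⟨⟨p, hp⟩, by simp [σ]⟩
    · rintro ⟨y, hy⟩
      rw [← hy]
      exact map_zero π
  · intro x
    refine (sub_eq_zero.1 ?_).symm
    rw [LinearMap.comp_apply, LinearMap.comp_apply, ← map_sub, hmk]
    exact ⟨x, by simp [σ]⟩

variable {κ : Type} {F : κ → ModuleCat.{u} A}

theorem Filtered.quotient_range_comp {X₁ X₂ : Type u} [AddCommGroup X₁] [Module A X₁]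
    [AddCommGroup X₂] [Module A X₂] {ι₁ : X →ₗ[A] X₁} {ι₂ : X₁ →ₗ[A] X₂}
    (hι₂ : Function.Injective ι₂)
    (h₁ : Filtered F (ModuleCat.of A (X₁ ⧸ LinearMap.range ι₁)))
    (h₂ : Filtered F (ModuleCat.of A (X₂ ⧸ LinearMap.range ι₂))) :
    Filtered F (ModuleCat.of A (X₂ ⧸ LinearMap.range (ι₂ ∘ₗ ι₁))) := by
  have hle : LinearMap.range (ι₂ ∘ₗ ι₁) ≤ LinearMap.range ι₂ := LinearMap.range_comp_le_range _ _
  refine h₁.of_exact h₂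
    ((LinearMap.range ι₁).mapQ (LinearMap.range (ι₂ ∘ₗ ι₁)) ι₂ ?_) ?_
    (Submodule.factor hle) (Submodule.factor_surjective hle) ?_
  · rintro _ ⟨x, rfl⟩
    exact ⟨x, rfl⟩
  · rw [injective_iff_map_eq_zero]
    intro z hz
    obtain ⟨x, rfl⟩ := Submodule.mkQ_surjective _ z
    obtain ⟨y, hy⟩ := (Submodule.Quotient.mk_eq_zero (LinearMap.range (ι₂ ∘ₗ ι₁))).1 hz
    exact (Submodule.Quotient.mk_eq_zero _).2 ⟨y, hι₂ hy⟩
  · intro z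
    obtain ⟨x, rfl⟩ := Submodule.mkQ_surjective _ z
    constructor
    · intro h
      obtain ⟨y, rfl⟩ := (Submodule.Quotient.mk_eq_zero (LinearMap.range ι₂)).1 h
      exact ⟨(LinearMap.range ι₁).mkQ y, rfl⟩
    · rintro ⟨w, hw⟩
      obtain ⟨y, rfl⟩ := Submodule.mkQ_surjective _ w
      rw [← hw]
      exact (Submodule.Quotient.mk_eq_zero (LinearMap.range ι₂)).2 ⟨y, rfl⟩

/-- Iterated pushouts: finitely many homomorphisms `ker π → X` become extendable to `P` after
enlarging `X` by a module filtered by copies of `D`. -/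
theorem exists_extension_of_list {π : P →ₗ[A] D} (hπ : Function.Surjective π)
    (fs : List (LinearMap.ker π →ₗ[A] X)) :
    ∃ (X' : ModuleCat.{u} A) (ι : X →ₗ[A] X'), Function.Injective ι ∧
      Filtered (fun _ : Unit => ModuleCat.of A D) (ModuleCat.of A (X' ⧸ LinearMap.range ι)) ∧
      ∀ f ∈ fs, ∃ e : P →ₗ[A] X', ∀ x : LinearMap.ker π, e x = ι (f x) := by
  induction fs with
  | nil =>
    refine ⟨ModuleCat.of A X, LinearMap.id, Function.injective_id, ?_, by simp⟩
    have : Subsingleton (X ⧸ LinearMap.range (LinearMap.id : X →ₗ[A] X)) :=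
      Submodule.Quotient.subsingleton_iff.2 LinearMap.range_id
    exact .of_subsingleton _
  | cons f fs ih =>
    obtain ⟨X₁, ι₁, hι₁, hF₁, he₁⟩ := ih
    obtain ⟨X₂, ι₂, g, e, hι₂, hg, hex, he⟩ := exists_pushout_extension hπ (ι₁ ∘ₗ f)
    refine ⟨X₂, ι₂ ∘ₗ ι₁, hι₂.comp hι₁, hF₁.quotient_range_comp hι₂ ?_, fun f' hf' => ?_⟩
    · refine (Filtered.single ()).of_equiv ?_
      rw [← (LinearMap.exact_iff.1 hex)]
      exact (g.quotKerEquivOfSurjective hg).symm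
    · rcases List.mem_cons.1 hf' with rfl | hf'
      · exact ⟨e, he⟩
      · obtain ⟨e', he'⟩ := he₁ f' hf'
        exact ⟨ι₂ ∘ₗ e', fun x => congrArg ι₂ (he' x)⟩

/-- A universal extension: over a finite-dimensional algebra one can enlarge `X` by a module
filtered by copies of `D = P / ker π` such that all homomorphisms `ker π → X` extend to `P`. -/
theorem exists_universal_extension (k : Type v) [Field k] [Algebra k A] [FiniteDimensional k A]
    [Module.Finite A P] [Module.Finite A X] {π : P →ₗ[A] D} (hπ : Function.Surjective π) :
    ∃ (X' : ModuleCat.{u} A) (ι : X →ₗ[A] X'), Function.Injective ι ∧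
      Filtered (fun _ : Unit => ModuleCat.of A D) (ModuleCat.of A (X' ⧸ LinearMap.range ι)) ∧
      ∀ f : LinearMap.ker π →ₗ[A] X, ∃ e : P →ₗ[A] X', ∀ x : LinearMap.ker π, e x = ι (f x) := by
  have htower : ∀ (M : Type u) [AddCommGroup M] [Module A M],
      let _ := Module.compHom M (algebraMap k A)
      IsScalarTower k A M := fun M _ _ =>
    let _ := Module.compHom M (algebraMap k A)
    ⟨fun c a x => by
      rw [Algebra.smul_def, mul_smul]
      rfl⟩
  let _ := Module.compHom P (algebraMap k A)
  let _ := Module.compHom X (algebraMap k A)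
  have := htower P
  have := htower X
  have := IsArtinianRing.of_finite k A
  have : Module.Finite k (LinearMap.ker π) := Module.Finite.trans A _
  have : Module.Finite k X := Module.Finite.trans A _
  have : Module.Finite k (LinearMap.ker π →ₗ[A] X) :=
    Module.Finite.of_injective (LinearMap.restrictScalarsₗ k A (LinearMap.ker π) X k)
      (LinearMap.restrictScalars_injective k)
  obtain ⟨s, hs⟩ := Module.Finite.fg_top (R := k) (M := LinearMap.ker π →ₗ[A] X)
  obtain ⟨X', ι, hι, hF, he⟩ := exists_extension_of_list hπ s.toList
  refine ⟨X', ι, hι, hF, fun f => ?_⟩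
  let _ := Module.compHom X' (algebraMap k A)
  have := htower X'
  have hf : f ∈ Submodule.span k (s : Set (LinearMap.ker π →ₗ[A] X)) := hs ▸ Submodule.mem_top
  induction hf using Submodule.span_induction with
  | mem f hf => exact he f (Finset.mem_toList.2 hf)
  | zero => exact ⟨0, fun x => (map_zero ι).symm⟩
  | add f₁ f₂ _ _ h₁ h₂ =>
    obtain ⟨e₁, he₁⟩ := h₁
    obtain ⟨e₂, he₂⟩ := h₂
    exact ⟨e₁ + e₂, fun x => by simp [he₁, he₂]⟩
  | smul c f _ h =>
    obtain ⟨e, he⟩ := h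
    refine ⟨c • e, fun x => ?_⟩
    rw [LinearMap.smul_apply, he, LinearMap.smul_apply]
    exact (map_smul ι (algebraMap k A c) (f x)).symm

end UniversalExtensions

namespace SimpleData

variable {A : Type u} [Ring A] {n : ℕ} (S : SimpleData A n)

theorem omits_of_filtered {κ : Type} {F : κ → ModuleCat.{u} A} {m : Fin n}
    (hF : ∀ i, S.Omits (F i) m) {M : Type u} [AddCommGroup M] [Module A M]
    (h : Filtered F (ModuleCat.of A M)) : S.Omits M m := by
  refine Filtered.induction (motive := fun M _ _ => S.Omits M m) ?_ ?_ h
  · intro M _ _ _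
    exact omits_of_subsingleton m
  · intro M _ _ j g _ _ ih
    exact .of_extension ih (hF j)

/-- The universal extension of `X` by copies of `Δ(r)` kills `Ext¹(Δ(r), X)` and preserves the
vanishing of `Ext¹(Δ(m), X)` for `m > r`. -/
theorem exists_extension_Δ (k : Type v) [Field k] [Algebra k A] [FiniteDimensional k A]
    (r : Fin n) {X : Type u} [AddCommGroup X] [Module A X] [Module.Finite A X]
    (hX : ∀ m, r < m → ExtVanishes A (S.Δ m) X) :
    ∃ (X' : ModuleCat.{u} A) (ι : X →ₗ[A] X'), Function.Injective ι ∧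
      Filtered (fun _ : Unit => S.Δ r) (ModuleCat.of A (X' ⧸ LinearMap.range ι)) ∧
      ∀ m, r ≤ m → ExtVanishes A (S.Δ m) X' := by
  have := S.finite_P r
  obtain ⟨X', ι, hι, hF, he⟩ := exists_universal_extension k (X := X) (S.toΔ_surjective r)
  have hQ : ∀ m, r ≤ m → ExtVanishes A (S.Δ m) (X' ⧸ LinearMap.range ι) := fun m hm =>
    S.extVanishes_Δ_of_omits fun s hs =>
      S.omits_of_filtered (fun _ => S.omits_Δ (hm.trans_lt hs)) hF
  refine ⟨X', ι, hι, hF, fun m hm => ?_⟩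
  rcases hm.lt_or_eq with hm' | rfl
  · refine .of_extension_right (Submodule.mkQ_surjective _) ?_ (hQ m hm)
    rw [Submodule.ker_mkQ]
    exact (hX m hm').congr_right (LinearEquiv.ofInjective ι hι)
  · refine .of_presentation (S.toΔ_surjective r) fun h => ?_
    obtain ⟨a, ha⟩ := hQ r le_rfl _ _ (S.toΔ_surjective r) ((LinearMap.range ι).mkQ ∘ₗ h)
    obtain ⟨b, hb⟩ := Module.projective_lifting_property _ a
      (Submodule.mkQ_surjective (LinearMap.range ι))
    have hb' : ∀ x, (LinearMap.range ι).mkQ (b x) = a x := LinearMap.congr_fun hb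
    obtain ⟨f, hf⟩ := exists_lift_of_injective hι (h - b ∘ₗ (LinearMap.ker _).subtype) fun x => by
      refine (Submodule.Quotient.mk_eq_zero (LinearMap.range ι)).1 ?_
      rw [← Submodule.mkQ_apply, LinearMap.sub_apply, map_sub]
      exact sub_eq_zero.2 ((ha x).symm.trans (hb' x).symm)
    obtain ⟨e, he⟩ := he f
    refine ⟨b + e, fun x => ?_⟩
    rw [LinearMap.add_apply, he, hf]
    exact add_sub_cancel _ _

/-- The standard modules `Δ(i)` with `i < c`. -/
noncomputable def ΔLT (c : ℕ) (i : {i : Fin n // (i : ℕ) < c}) : ModuleCat.{u} A := S.Δ i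

theorem filtered_Δ_of_ΔLT {c : ℕ} {M : Type u} [AddCommGroup M] [Module A M]
    (h : Filtered (S.ΔLT c) (ModuleCat.of A M)) : Filtered S.Δ (ModuleCat.of A M) :=
  h.reindex Subtype.val fun _ => rfl

/-- Every `X` filtered by `Δ(i)` with `i ≤ c` embeds in a module `X'` with `Ext¹(Δ(m), X') = 0`
for all `m`, such that `X' / X` is filtered by `Δ(i)` with `i < c`. -/
theorem exists_embedding_extVanishes (k : Type v) [Field k] [Algebra k A] [FiniteDimensional k A]
    {c : ℕ} {X : Type u} [AddCommGroup X] [Module A X]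
    (h : Filtered (S.ΔLT (c + 1)) (ModuleCat.of A X)) :
    ∃ (X' : ModuleCat.{u} A) (ι : X →ₗ[A] X'), Function.Injective ι ∧
      Filtered (S.ΔLT c) (ModuleCat.of A (X' ⧸ LinearMap.range ι)) ∧
      ∀ m, ExtVanishes A (S.Δ m) X' := by
  have hfin := h.finite fun i => S.finite_Δ i
  -- `Ext¹(Δ(m), X)` is killed for `m = c - 1, …, 0` in turn; it vanishes for `m ≥ c`.
  suffices H : ∀ d r : ℕ, r + d = c → ∃ (X' : ModuleCat.{u} A) (ι : X →ₗ[A] X'),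
      Function.Injective ι ∧ Filtered (S.ΔLT c) (ModuleCat.of A (X' ⧸ LinearMap.range ι)) ∧
      ∀ m : Fin n, r ≤ m → ExtVanishes A (S.Δ m) X' by
    obtain ⟨X', ι, hι, hF, hE⟩ := H c 0 (zero_add c)
    exact ⟨X', ι, hι, hF, fun m => hE m (Nat.zero_le _)⟩
  intro d
  induction d with
  | zero =>
    rintro r rfl
    refine ⟨ModuleCat.of A X, LinearMap.id, Function.injective_id, ?_, fun m hm => ?_⟩
    · have : Subsingleton (X ⧸ LinearMap.range (LinearMap.id : X →ₗ[A] X)) :=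
        Submodule.Quotient.subsingleton_iff.2 LinearMap.range_id
      exact .of_subsingleton _
    · refine S.extVanishes_Δ_of_omits fun s hs => S.omits_of_filtered (fun i => S.omits_Δ ?_) h
      have := i.2
      have : (m : ℕ) < s := hs
      exact Fin.lt_def.2 (by omega)
  | succ d ih =>
    intro r hr
    obtain ⟨X₁, ι₁, hι₁, hF₁, hE₁⟩ := ih (r + 1) (by omega)
    rcases lt_or_ge r n with hrn | hrn
    · have : Module.Finite A (X₁ ⧸ LinearMap.range ι₁) := hF₁.finite fun i => S.finite_Δ i
      have : Module.Finite A X₁ := .of_submodule_quotient (LinearMap.range ι₁)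
      obtain ⟨X₂, ι₂, hι₂, hF₂, hE₂⟩ := S.exists_extension_Δ k ⟨r, hrn⟩ (X := X₁)
        fun m hm => hE₁ m hm
      exact ⟨X₂, ι₂ ∘ₗ ι₁, hι₂.comp hι₁, hF₁.quotient_range_comp hι₂
        (hF₂.reindex (fun _ => ⟨⟨r, hrn⟩, by dsimp only; omega⟩) fun _ => rfl), hE₂⟩
    · exact ⟨X₁, ι₁, hι₁, hF₁, fun m hm => absurd m.2 (by omega)⟩

end SimpleData

/-! ### Projective dimension and filtered resolutions -/

section Dimensions

variable {A : Type u} [Ring A]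
variable {X Y Z : Type u} [AddCommGroup X] [Module A X] [AddCommGroup Y] [Module A Y]
  [AddCommGroup Z] [Module A Z]

theorem shortExact_of_function_exact {f : X →ₗ[A] Y} {g : Y →ₗ[A] Z} (hf : Function.Injective f)
    (hg : Function.Surjective g) (hfg : Function.Exact f g) :
    (ModuleCat.shortComplexOfCompEqZero f g hfg.linearMap_comp_eq_zero).ShortExact :=
  ModuleCat.shortComplex_shortExact _ hfg hf hg

theorem hasProjectiveDimensionLT_pi {T : ModuleCat.{u} A} {N : ℕ}
    (hT : HasProjectiveDimensionLT T N) (m : ℕ) :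
    HasProjectiveDimensionLT (ModuleCat.of A (Fin m → T)) N := by
  induction m with
  | zero =>
    have := (ModuleCat.isZero_of_subsingleton
      (ModuleCat.of A (Fin 0 → T))).hasProjectiveDimensionLT_zero
    exact hasProjectiveDimensionLT_of_ge _ 0 N (Nat.zero_le N)
  | succ m ih =>
    have h := (shortExact_of_function_exact (LinearMap.inl_injective (R := A) (M := T)
      (M₂ := Fin m → T)) LinearMap.snd_surjective .inl_snd).hasProjectiveDimensionLT_X₂ N hT ih
    exact hasProjectiveDimensionLT_of_iso
      (Fin.consLinearEquiv A fun _ : Fin (m + 1) => T).toModuleIso N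

theorem InAdd.hasProjectiveDimensionLT {T M : ModuleCat.{u} A} (h : InAdd T M) {N : ℕ}
    (hT : HasProjectiveDimensionLT T N) : HasProjectiveDimensionLT M N := by
  obtain ⟨m, i, r, hri⟩ := h
  have := hasProjectiveDimensionLT_pi hT m
  exact (Retract.mk (Y := ModuleCat.of A (Fin m → T)) (ModuleCat.ofHom i) (ModuleCat.ofHom r)
    (ModuleCat.hom_ext hri)).hasProjectiveDimensionLT N

variable {κ : Type} {F : κ → ModuleCat.{u} A}

theorem HasFilteredResolution.of_filtered {M : ModuleCat.{u} A} (h : Filtered F M) :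
    HasFilteredResolution F M 0 := by
  have hz : Filtered F (ModuleCat.of A PUnit.{u + 1}) := .of_subsingleton _
  refine ⟨fun i => Nat.casesOn i M fun _ => ModuleCat.of A PUnit.{u + 1}, fun _ => 0,
    LinearMap.id, ?_, ?_, Function.surjective_id, fun x => ?_, fun i x => ?_⟩
  · rintro (_ | i)
    · exact h
    · exact hz
  · rintro (_ | i) hi
    · exact absurd hi (lt_irrefl 0)
    · exact inferInstanceAs (Subsingleton PUnit)
  · exact ⟨fun hx => ⟨0, hx.symm⟩, fun ⟨_, hy⟩ => hy.symm⟩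
  · exact ⟨fun _ => ⟨0, Subsingleton.elim (α := PUnit) _ _⟩, fun _ => rfl⟩

/-- Splicing a resolution of the kernel of `ε : R₀ → M` with `ε`. -/
theorem HasFilteredResolution.of_ker {M R₀ : ModuleCat.{u} A} (hR₀ : Filtered F R₀)
    {ε : R₀ →ₗ[A] M} (hε : Function.Surjective ε) {l : ℕ}
    (h : HasFilteredResolution F (ModuleCat.of A (LinearMap.ker ε)) l) :
    HasFilteredResolution F M (l + 1) := by
  obtain ⟨R, d, ε', hR, hRl, hε', hdε', hd⟩ := h
  change R 0 →ₗ[A] LinearMap.ker ε at ε'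
  refine ⟨fun i => Nat.casesOn i R₀ R, fun i => match i with
    | 0 => (LinearMap.ker ε).subtype ∘ₗ ε'
    | i + 1 => d i, ε, ?_, ?_, hε, fun x => ?_, ?_⟩
  · rintro (_ | i)
    · exact hR₀
    · exact hR i
  · rintro (_ | i) hi
    · exact absurd hi (Nat.not_lt_zero _)
    · exact hRl i (Nat.lt_of_succ_lt_succ hi)
  · constructor
    · intro hx
      obtain ⟨y, hy⟩ := hε' ⟨x, hx⟩
      exact ⟨y, congrArg Subtype.val hy⟩
    · rintro ⟨y, rfl⟩
      exact (ε' y).2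
  · rintro (_ | i)
    · intro x
      refine Iff.trans ?_ (hdε' x)
      exact ⟨fun hx => Subtype.ext hx, fun hx => congrArg Subtype.val hx⟩
    · exact hd i

theorem HasFilteredResolution.hasProjectiveDimensionLT {N : ℕ}
    (hF : ∀ M : ModuleCat.{u} A, Filtered F M → HasProjectiveDimensionLT M (N + 1)) {l : ℕ}
    {M : ModuleCat.{u} A} (h : HasFilteredResolution F M l) :
    HasProjectiveDimensionLT M (l + N + 1) := by
  induction l generalizing M with
  | zero =>
    obtain ⟨R, d, ε, hR, hRl, hε, hdε, hd⟩ := h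
    have := hRl 1 Nat.zero_lt_one
    rw [Nat.zero_add]
    refine hF M (Filtered.of_equiv (hR 0) (LinearEquiv.ofBijective ε ⟨?_, hε⟩))
    rw [injective_iff_map_eq_zero]
    intro x hx
    obtain ⟨y, rfl⟩ := (hdε x).1 hx
    rw [Subsingleton.elim y 0, map_zero]
  | succ l ih =>
    obtain ⟨R, d, ε, hR, hRl, hε, hdε, hd⟩ := h
    have hker : HasFilteredResolution F (ModuleCat.of A (LinearMap.ker ε)) l := by
      refine ⟨fun i => R (i + 1), fun i => d (i + 1),
        (d 0).codRestrict (LinearMap.ker ε) fun x => (hdε _).2 ⟨x, rfl⟩, fun i => hR _,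
        fun i hi => hRl _ (Nat.succ_lt_succ hi), fun x => ?_, fun x => ?_, fun i => hd _⟩
      · obtain ⟨y, hy⟩ := (hdε x.1).1 x.2
        exact ⟨y, Subtype.ext hy⟩
      · refine Iff.trans ?_ (hd 0 x)
        exact ⟨fun hx => congrArg Subtype.val hx, fun hx => Subtype.ext hx⟩
    have h0 := hF _ (hR 0)
    have := (LinearMap.shortExact_shortComplexKer hε).hasProjectiveDimensionLT_X₃ (l + N + 1)
      (ih hker) (hasProjectiveDimensionLT_of_ge _ (N + 1) _ (by omega))
    rwa [show l + 1 + N + 1 = l + N + 1 + 1 by omega]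

theorem exists_eq_filtrationDim {M : ModuleCat.{u} A} {d : ℕ}
    (h : HasFilteredResolution F M d) :
    ∃ l : ℕ, HasFilteredResolution F M l ∧ filtrationDim F M = l := by
  have : Nonempty {l // HasFilteredResolution F M l} := ⟨⟨d, h⟩⟩
  obtain ⟨⟨l, hl⟩, hl'⟩ := ENat.exists_eq_iInf
    fun l : {l // HasFilteredResolution F M l} => ((l : ℕ) : ℕ∞)
  refine ⟨l, hl, ?_⟩
  rw [filtrationDim, iInf_subtype']
  exact hl'.symm

end Dimensions

/-! ### Projective dimension over an SSS-algebra -/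

namespace SimpleData

variable {A : Type u} [Ring A] {n : ℕ} {S : SimpleData A n}

/-- `pd X ≤ pd T` for `X ∈ 𝓕(Δ)`, by induction on the largest index of a factor `Δ(i)` of `X`:
there is an exact sequence `0 → X → T₀ → Y → 0` with `T₀ ∈ add T` in which `Y ∈ 𝓕(Δ)` only has
factors of smaller index. -/
theorem IsSSS.hasProjectiveDimensionLT_of_ΔLT (k : Type v) [Field k] [Algebra k A]
    [FiniteDimensional k A] (hA : S.IsSSS) {T : ModuleCat.{u} A}
    (hT : S.IsCharacteristicTilting T) {N : ℕ} (hTN : HasProjectiveDimensionLT T N) {c : ℕ}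
    {X : ModuleCat.{u} A} (hX : Filtered (S.ΔLT c) X) : HasProjectiveDimensionLT X N := by
  have := IsArtinianRing.of_finite k A
  induction c generalizing X with
  | zero =>
    have : Subsingleton X := by
      refine Filtered.induction (X := S.ΔLT 0) (motive := fun M _ _ => Subsingleton M) ?_ ?_ hX
      · exact fun M _ _ h => h
      · exact fun M _ _ j => absurd j.2 (Nat.not_lt_zero _)
    have := (ModuleCat.isZero_of_subsingleton X).hasProjectiveDimensionLT_zero
    exact hasProjectiveDimensionLT_of_ge _ 0 N (Nat.zero_le N)
  | succ c ih =>
    obtain ⟨T₀, ι, hι, hF, hE⟩ := S.exists_embedding_extVanishes k hX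
    have hexact := LinearMap.exact_map_mkQ_range ι
    have hTΔ : Filtered S.Δ T₀ := (S.filtered_Δ_of_ΔLT hX).of_exact (S.filtered_Δ_of_ΔLT hF) ι hι _
      (Submodule.mkQ_surjective _) hexact
    have : Module.Finite A T₀ := Filtered.finite hTΔ S.finite_Δ
    have hT₀ : InAdd T T₀ := (hT.2 T₀ this).2
      ⟨hTΔ, hA.filtered_properCostd (S.finite_properCostd k) hE⟩
    have hY := ih hF
    exact (shortExact_of_function_exact hι (Submodule.mkQ_surjective _)
      hexact).hasProjectiveDimensionLT_X₁ N (hT₀.hasProjectiveDimensionLT hTN)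
        (hasProjectiveDimensionLT_of_ge _ N (N + 1) (Nat.le_succ N))

theorem IsSSS.hasProjectiveDimensionLT_of_Δ (k : Type v) [Field k] [Algebra k A]
    [FiniteDimensional k A] (hA : S.IsSSS) {T : ModuleCat.{u} A}
    (hT : S.IsCharacteristicTilting T) {N : ℕ} (hTN : HasProjectiveDimensionLT T N)
    {X : ModuleCat.{u} A} (hX : Filtered S.Δ X) : HasProjectiveDimensionLT X N :=
  hA.hasProjectiveDimensionLT_of_ΔLT k hT hTN (c := n)
    (Filtered.reindex hX (fun i => ⟨i, i.2⟩) fun _ => rfl)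

/-- A finite module of projective dimension at most `d` has a resolution of length `d` by modules in
`𝓕(Δ)`, since `𝓕(Δ)` contains all finite projective modules. -/
theorem IsSSS.hasFilteredResolution [IsArtinianRing A] (hA : S.IsSSS) {d : ℕ}
    {M : ModuleCat.{u} A} [Module.Finite A M] (hM : HasProjectiveDimensionLT M (d + 1)) :
    HasFilteredResolution S.Δ M d := by
  induction d generalizing M with
  | zero =>
    have := (IsProjective.iff_projective M).2
      (projective_iff_hasProjectiveDimensionLT_one.2 hM)
    exact .of_filtered (hA.filtered_Δ fun _ => .of_projective)
  | succ d ih =>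
    obtain ⟨m, ε, hε⟩ := Module.Finite.exists_fin' A M
    have hproj : Projective (ModuleCat.of A (Fin m → A)) := inferInstance
    refine .of_ker (R₀ := ModuleCat.of A (Fin m → A)) (Filtered.pi hA m) hε (ih ?_)
    exact ((LinearMap.shortExact_shortComplexKer hε).hasProjectiveDimensionLT_X₃_iff d hproj).1 hM

/-- `pd M ≤ l + pd T` if `M` has a resolution of length `l` by modules in `𝓕(Δ)`. -/
theorem IsSSS.projectiveDimension_le (k : Type v) [Field k] [Algebra k A]
    [FiniteDimensional k A] (hA : S.IsSSS) {T : ModuleCat.{u} A}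
    (hT : S.IsCharacteristicTilting T) {l : ℕ} {M : ModuleCat.{u} A}
    (h : HasFilteredResolution S.Δ M l) :
    projectiveDimension M ≤ ((l : ℕ∞) : WithBot ℕ∞) + projectiveDimension T := by
  generalize hd : projectiveDimension T = d
  induction d with
  | bot =>
    -- `T = 0` forces `A = 0`, as `A ∈ 𝓕(Δ)`.
    have hT0 : HasProjectiveDimensionLT T 0 := by
      rw [hasProjectiveDimensionLT_zero_iff_isZero, ← projectiveDimension_eq_bot_iff, hd]
    have hA0 : HasProjectiveDimensionLT (ModuleCat.of A A) 0 :=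
      hA.hasProjectiveDimensionLT_of_Δ k hT hT0 hA
    have : Subsingleton A := ModuleCat.subsingleton_of_isZero
      ((hasProjectiveDimensionLT_zero_iff_isZero _).1 hA0)
    have : Subsingleton M := Module.subsingleton A M
    rw [(projectiveDimension_eq_bot_iff M).2 (ModuleCat.isZero_of_subsingleton M)]
    exact bot_le
  | coe d =>
    induction d with
    | top =>
      rw [← WithBot.coe_add, add_top]
      exact le_top
    | coe d =>
      have hTd : HasProjectiveDimensionLT T (d + 1) :=
        (projectiveDimension_le_iff T d).1 hd.le
      have := h.hasProjectiveDimensionLT fun X hX =>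
        hA.hasProjectiveDimensionLT_of_Δ k hT hTd hX
      exact (projectiveDimension_le_iff M (l + d)).2 this

end SimpleData

end Strat

theorem theorem3 (k : Type v) [Field k] [IsAlgClosed k] (A : Type u) [Ring A] [Algebra k A]
    [FiniteDimensional k A] (n : ℕ) (S : Strat.SimpleData A n) (hA : S.IsSSS)
    (T : ModuleCat.{u} A) (hT : S.IsCharacteristicTilting T) :
    Strat.fdim A ≤ (S.fdimΔ : WithBot ℕ∞) + projectiveDimension T := by
  have := IsArtinianRing.of_finite k A
  refine iSup_le fun M => iSup_le fun hfin => iSup_le fun hpd => ?_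
  obtain ⟨d, hd⟩ := (projectiveDimension_ne_top_iff M).1 hpd
  obtain ⟨l, hl, hdim⟩ := Strat.exists_eq_filtrationDim (hA.hasFilteredResolution hd)
  refine (hA.projectiveDimension_le k hT hl).trans (add_le_add_left (WithBot.coe_le_coe.2 ?_) _)
  rw [← hdim]
  exact le_iSup_of_le M (le_iSup_of_le hfin
    (le_iSup_of_le (hdim ▸ ENat.natCast_ne_top l) le_rfl))
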